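/- Let $k$ be an algebraically closed field and let $n,s\ge 1$ be integers. Let $Q=Q^{(n,s+1)}$ be the quiver with vertex set $I=\{x=(x_0,\dots,x_n)\in\mathbb Z_{\ge 0}^{n+1}\mid \sum_i x_i=s\}$ and with an arrow $\alpha_i:x\to x+f_i$ for every $i\in\{0,\dots,n\}$ and every $x\in I$ with $x+f_i\in I$; here $f_i$ has entry $-1$ in position $i-1$ and entry $1$ in position $i$, positions being read modulo $n+1$, and all other entries $0$. Paths are composed from left to right, $e_x$ denotes the idempotent at $x$, and modules are right modules. Let $\Gamma=\Gamma(Z^n_s)$ be the quasi-hereditary cover of the higher zigzag-algebra $Z^n_s$, that is, the quotient of $kQ$ by the relations $\alpha_i\alpha_j=\alpha_j\alpha_i$ (at every vertex from which both paths exist), $\alpha_i\alpha_i=0$, and $e_z\alpha_0\alpha_1=0$ for all $z\in I$ with $z_0=0$. Order $I$ by $x\le y$ if there is a path from $x$ to $y$ in $Q$ that involves no arrow $\alpha_0$. For a finite-dimensional algebra $\Lambda$ whose simple modules $S_i$ (with projective covers $P_i$) are labelled by a poset $I$, the standard module $\Delta_i$ is the largest quotient of $P_i$ without composition factor $S_j$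 for $i<j$. The algebra $\Lambda$ is quasi-hereditary if $\operatorname{End}_\Lambda(\Delta_i)\cong k$ for all $i$ and $\Lambda_\Lambda$ has a filtration whose subquotients are standard modules; it is directed if moreover all $\Delta_i$ are simple. A subalgebra $B$ of a quasi-hereditary algebra $\Lambda$ is an exact Borel subalgebra if its simple modules are labelled by the same poset, $B$ is directed, the functor $-\otimes_B\Lambda$ is exact, and it sends the simple $B$-module with label $i$ to $\Delta_i$ for every $i$. It is strong if $\Lambda$ has a maximal semisimple subalgebra that is also a maximal semisimple subalgebra of $B$. Let $B\subseteq\Gamma$ be the subalgebra generated by the idempotents $e_x$, $x\in I$, and all arrows $\alpha_i$ with $i\ne 0$. Then: 1. $B$ is the path algebra of the quiver $Q'$ with vertex set $I$ and arrows $\alpha_i$, $i\neq 0$, bound by the relations $\alpha_i\alpha_j=\alpha_j\alpha_i$ (whenever both paths exist) and $\alpha_i\alpha_i=0$: the canonical homomorphism from this bound quiver algebra to $\Gamma$ is injective with image $B$. 2. $B$ is directed, with simple modules labelled by the poset $I$ through the idempotents $e_x$. 3. $B$ is isomorphic, as a $k$-algebra, to the quadratic dual of the higher Auslander algebra $\Lambda^{(n,s+1)}$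 of type $A_{s+1}$, that is, of the quotient of $kQ'$ by the relations, for every path $x\xrightarrow{\alpha_i}x+f_i\xrightarrow{\alpha_j}x+f_i+f_j$ in $Q'$, $\alpha_i\alpha_j=\alpha_j\alpha_i$ if $x+f_j\in I$ and $\alpha_i\alpha_j=0$ otherwise. (The quadratic dual of $kQ'/(R)$, with $R$ spanned by combinations of paths of length two, is $kQ'^{\,\mathrm{op}}/(R^{\perp})$.) 4. $\Gamma$ is quasi-hereditary and $B$ is a strong exact Borel subalgebra of $\Gamma$, the simple modules of both algebras being labelled by the poset $I$ through the idempotents $e_x$. -/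

import Mathlib

open scoped TensorProduct

universe u

noncomputable section

/-! ### Quivers, path algebras with quadratic relations, quadratic duals -/

/-- A path of length two `x --a--> y --b--> z` in a quiver, read from left to right. -/
structure TwoPath (V : Type) [Quiver.{0} V] where
  {x y z : V}
  a : x ⟶ y
  b : y ⟶ z

/-- The path of length two in the opposite quiver obtained by reversing a path. -/
def TwoPath.op {V : Type} [Quiver.{0} V] (p : TwoPath V) : TwoPath Vᵒᵖ :=
  ⟨p.b.op, p.a.op⟩

section QuiverAlgebra

variable (k : Type u) [Field k] (V : Type) [Quiver.{0} V] [Fintype V]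

/-- The free algebra on the vertices and the arrows of a quiver. -/
abbrev PreAlg : Type u := FreeAlgebra k (V ⊕ Quiver.Total V)

variable {V}

/-- The generator attached to a vertex. -/
def PreAlg.vertex (x : V) : PreAlg k V := FreeAlgebra.ι k (Sum.inl x)

/-- The generator attached to an arrow. -/
def PreAlg.arrow {x y : V} (a : x ⟶ y) : PreAlg k V := FreeAlgebra.ι k (Sum.inr ⟨x, y, a⟩)

/-- The defining relations of the path algebra of a finite quiver (the vertices are orthogonal
idempotents with sum `1`, and an arrow `a : x ⟶ y` satisfies `e_x a = a = a e_y`, so that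
products of paths are concatenations read from left to right), together with the
quadratic relations `∑ c_p p = 0` for the elements `∑ c_p p` of `R`. -/
inductive BoundRel (R : Set (TwoPath V →₀ k)) : PreAlg k V → PreAlg k V → Prop
  | idem (x : V) : BoundRel R (PreAlg.vertex k x * PreAlg.vertex k x) (PreAlg.vertex k x)
  | orth (x y : V) (h : x ≠ y) : BoundRel R (PreAlg.vertex k x * PreAlg.vertex k y) 0
  | one : BoundRel R (∑ x : V, PreAlg.vertex k x) 1
  | source {x y : V} (a : x ⟶ y) :
      BoundRel R (PreAlg.vertex k x * PreAlg.arrow k a) (PreAlg.arrow k a)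
  | target {x y : V} (a : x ⟶ y) :
      BoundRel R (PreAlg.arrow k a * PreAlg.vertex k y) (PreAlg.arrow k a)
  | rel (r : TwoPath V →₀ k) (h : r ∈ R) :
      BoundRel R (r.sum fun p c => c • (PreAlg.arrow k p.a * PreAlg.arrow k p.b)) 0

/-- The bound quiver algebra `kQ / (R)`, for a finite quiver `Q` and a set `R` of
linear combinations of paths of length two. -/
def QuiverAlg (R : Set (TwoPath V →₀ k)) : Type u := RingQuot (BoundRel k R)

instance (R : Set (TwoPath V →₀ k)) : Ring (QuiverAlg k R) :=
  inferInstanceAs (Ring (RingQuot (BoundRel k R)))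

instance (R : Set (TwoPath V →₀ k)) : Algebra k (QuiverAlg k R) :=
  inferInstanceAs (Algebra k (RingQuot (BoundRel k R)))

/-- The idempotent `e_x` of the bound quiver algebra. -/
def QuiverAlg.e (R : Set (TwoPath V →₀ k)) (x : V) : QuiverAlg k R :=
  RingQuot.mkAlgHom k (BoundRel k R) (PreAlg.vertex k x)

/-- The class of an arrow in the bound quiver algebra. -/
def QuiverAlg.arrow (R : Set (TwoPath V →₀ k)) {x y : V} (a : x ⟶ y) : QuiverAlg k R :=
  RingQuot.mkAlgHom k (BoundRel k R) (PreAlg.arrow k a)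

/-- The orthogonal complement of a set of quadratic relations: the linear combinations of paths of
length two in the opposite quiver on which all elements of `R` vanish, for the pairing
that makes the paths of length two and the reversed paths dual bases. -/
def quadraticPerp (R : Set (TwoPath V →₀ k)) : Set (TwoPath Vᵒᵖ →₀ k) :=
  {d | ∀ r ∈ R, (r.sum fun p c => c * d p.op) = 0}

/-- The vertices of the opposite quiver of a finite quiver form a finite type. -/
instance oppositeVertexFintype : Fintype Vᵒᵖ := Fintype.ofEquiv V Opposite.equivToOpposite

/-- The quadratic dual `A^! = kQ^op / (R^⊥)` of the quadratic algebra `A = kQ / (R)`. -/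
abbrev QuadraticDual (R : Set (TwoPath V →₀ k)) : Type u := QuiverAlg k (quadraticPerp k R)

end QuiverAlgebra

/-! ### Quasi-hereditary algebras (right modules are modules over the opposite ring) -/

section QuasiHereditary

variable (k : Type u) [Field k] {Λ : Type u} [Ring Λ] [Algebra k Λ] {I : Type}

/-- The right ideal `eΛ`. -/
def rightIdeal (e : Λ) : Submodule Λᵐᵒᵖ Λ := Submodule.span Λᵐᵒᵖ {e}

/-- The top of `eΛ`, that is, its quotient by its radical. -/
abbrev topOf (e : Λ) : Type u := rightIdeal e ⧸ Module.jacobson Λᵐᵒᵖ (rightIdeal e)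

/-- `S` is (isomorphic to) a subquotient of `M`. For `S` simple and `M` of finite length this says
that `S` is a composition factor of `M`. -/
def HasCompositionFactor (R : Type u) [Ring R] (M S : Type u) [AddCommGroup M] [Module R M]
    [AddCommGroup S] [Module R S] : Prop :=
  ∃ N₁ N₂ : Submodule R M, N₁ ≤ N₂ ∧ Nonempty ((N₂ ⧸ N₁.submoduleOf N₂) ≃ₗ[R] S)

/-- The idempotents `e i` label the simple right `Λ`-modules by `I`: the modules
`S_i = top (e_i Λ)` are simple and every simple right module is isomorphic to exactly one of them.
Thus `e_i Λ` is the indecomposable projective module `P_i` with top `S_i`. -/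
structure LabelsSimples (e : I → Λ) : Prop where
  idem : ∀ i, IsIdempotentElem (e i)
  simple : ∀ i, IsSimpleModule Λᵐᵒᵖ (topOf (e i))
  exhaust : ∀ (S : Type u) [AddCommGroup S] [Module Λᵐᵒᵖ S], IsSimpleModule Λᵐᵒᵖ S →
    ∃! i, Nonempty (S ≃ₗ[Λᵐᵒᵖ] topOf (e i))

variable [PartialOrder I]

/-- The kernel of `P_i → Δ_i`: the smallest submodule `N` of `P_i` such that `P_i / N` has no
composition factor `S_j` with `i < j`. -/
def standardKernel (e : I → Λ) (i : I) : Submodule Λᵐᵒᵖ (rightIdeal (e i)) :=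
  sInf {N | ∀ j, i < j → ¬ HasCompositionFactor Λᵐᵒᵖ (rightIdeal (e i) ⧸ N) (topOf (e j))}

/-- The standard module `Δ_i`: the largest quotient of `P_i` without composition factor `S_j`
for `i < j`. -/
abbrev Standard (e : I → Λ) (i : I) : Type u := rightIdeal (e i) ⧸ standardKernel e i

/-- The right module `Λ_Λ` has a filtration whose successive quotients are standard modules. -/
def HasStandardFiltration (e : I → Λ) : Prop :=
  ∃ (m : ℕ) (M : Fin (m + 1) → Submodule Λᵐᵒᵖ Λ), Monotone M ∧ M 0 = ⊥ ∧ M (Fin.last m) = ⊤ ∧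
    ∀ j : Fin m, ∃ i : I, Nonempty
      ((M j.succ ⧸ (M j.castSucc).submoduleOf (M j.succ)) ≃ₗ[Λᵐᵒᵖ] Standard e i)

/-- `Λ` is a quasi-hereditary algebra, with simple modules labelled by the poset `I`. -/
structure IsQuasiHereditary (e : I → Λ) : Prop where
  finite : FiniteDimensional k Λ
  labels : LabelsSimples e
  endo : ∀ i, Nonempty (Module.End Λᵐᵒᵖ (Standard e i) ≃ₐ[k] k)
  filtration : HasStandardFiltration e

/-- A directed algebra: quasi-hereditary with simple standard modules. -/
structure IsDirectedAlgebra (e : I → Λ) : Prop where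
  quasiHereditary : IsQuasiHereditary k e
  simple : ∀ i, IsSimpleModule Λᵐᵒᵖ (Standard e i)

end QuasiHereditary

/-! ### Induction from a subalgebra and exact Borel subalgebras -/

section Borel

variable {k : Type u} [Field k] {Λ : Type u} [Ring Λ] [Algebra k Λ] (B : Subalgebra k Λ)

section Induction

variable (M : Type u) [AddCommGroup M] [Module Bᵐᵒᵖ M]

/-- The right `Λ`-submodule of `Λ ⊗_ℤ M` (with `Λ` acting by right multiplication on the first
factor) generated by the elements that identify `mb ⊗ l` with `m ⊗ bl`. -/
def balancing : Submodule Λᵐᵒᵖ (Λ ⊗[ℤ] M) :=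
  Submodule.span Λᵐᵒᵖ
    {t | ∃ (l : Λ) (b : B) (m : M), t = l ⊗ₜ[ℤ] (MulOpposite.op b • m) - ((b : Λ) * l) ⊗ₜ[ℤ] m}

/-- The right `Λ`-module `M ⊗_B Λ` induced from a right `B`-module `M`; the two tensor factors are
written in reverse order. -/
abbrev Induced : Type u := (Λ ⊗[ℤ] M) ⧸ balancing B M

end Induction

/-- The map `f ⊗_B Λ : M ⊗_B Λ → N ⊗_B Λ` induced by `f : M → N`. -/
def inducedMap {M N : Type u} [AddCommGroup M] [Module Bᵐᵒᵖ M] [AddCommGroup N] [Module Bᵐᵒᵖ N]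
    (f : M →ₗ[Bᵐᵒᵖ] N) : Induced B M →ₗ[Λᵐᵒᵖ] Induced B N :=
  Submodule.mapQ (balancing B M) (balancing B N)
    (TensorProduct.AlgebraTensorModule.map (LinearMap.id : Λ →ₗ[Λᵐᵒᵖ] Λ)
      f.toAddMonoidHom.toIntLinearMap)
    (by
      rw [balancing, Submodule.span_le]
      rintro _ ⟨l, b, m, rfl⟩
      refine Submodule.subset_span ⟨l, b, f m, ?_⟩
      simp [map_sub])

/-- The functor `- ⊗_B Λ` from right `B`-modules to right `Λ`-modules is exact. -/
def InductionExact : Prop :=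
  ∀ (L M N : Type u) [AddCommGroup L] [Module Bᵐᵒᵖ L] [AddCommGroup M] [Module Bᵐᵒᵖ M]
    [AddCommGroup N] [Module Bᵐᵒᵖ N] (f : L →ₗ[Bᵐᵒᵖ] M) (g : M →ₗ[Bᵐᵒᵖ] N),
    Function.Exact f g → Function.Exact (inducedMap B f) (inducedMap B g)

variable {I : Type} [PartialOrder I]

/-- `B` is an exact Borel subalgebra of the quasi-hereditary algebra `Λ`. The simple modules of
`Λ` and of `B` are labelled by the same poset `I`, through the idempotents `e i` of `Λ` and
`f i` of `B`. -/
structure IsExactBorel (e : I → Λ) (f : I → B) : Prop where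
  quasiHereditary : IsQuasiHereditary k e
  directed : IsDirectedAlgebra k f
  exact : InductionExact B
  standard : ∀ i, Nonempty (Induced B (topOf (f i)) ≃ₗ[Λᵐᵒᵖ] Standard e i)

/-- `C` is a maximal semisimple subalgebra of `A`. -/
def IsMaximalSemisimple {A : Type u} [Ring A] [Algebra k A] (C : Subalgebra k A) : Prop :=
  Maximal (fun D : Subalgebra k A => IsSemisimpleRing D) C

/-- A strong exact Borel subalgebra: `Λ` and `B` have a common maximal semisimple subalgebra. -/
structure IsStrongExactBorel (e : I → Λ) (f : I → B) : Prop where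
  exactBorel : IsExactBorel B e f
  strong : ∃ C : Subalgebra k B, IsMaximalSemisimple C ∧ IsMaximalSemisimple (C.map B.val)

end Borel

/-! ### The quiver `Q^(n,s)`, the qh-cover, and the higher Auslander algebra of type `A` -/

/-- The vertices of `Q^(n,s)`: vectors `(x_0, …, x_n)` of natural numbers with sum `s - 1`. -/
def Vtx (n s : ℕ) : Type := {x : Fin (n + 1) → ℕ // ∑ i, x i + 1 = s}

instance (n s : ℕ) : Finite (Vtx n s) := by
  have h : ∀ (x : Vtx n s) (i : Fin (n + 1)), x.1 i < s := fun x i => by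
    have := Finset.single_le_sum (fun j _ => Nat.zero_le (x.1 j)) (Finset.mem_univ i)
    have := x.2
    omega
  refine Finite.of_injective (fun (x : Vtx n s) (i : Fin (n + 1)) => (⟨x.1 i, h x i⟩ : Fin s)) ?_
  intro x y hxy
  refine Subtype.ext (funext fun i => ?_)
  exact congrArg Fin.val (congrFun hxy i)

instance (n s : ℕ) : Fintype (Vtx n s) := Fintype.ofFinite _

/-- The vector `f_i`, with `-1` in position `i - 1` (cyclically) and `1` in position `i`. -/
def stepVec {n : ℕ} (i : Fin (n + 1)) : Fin (n + 1) → ℤ := Pi.single i 1 - Pi.single (i - 1) 1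

/-- The quiver `Q^(n,s)`: an arrow `α_i : x ⟶ y` whenever `y = x + f_i`. -/
instance (n s : ℕ) : Quiver.{0} (Vtx n s) where
  Hom x y := {i : Fin (n + 1) // ∀ j, (y.1 j : ℤ) = x.1 j + stepVec i j}

/-- A copy of the vertex set, carrying the subquiver `Q'` of `Q^(n,s)` without the arrows `α_0`. -/
def DirVtx (n s : ℕ) : Type := Vtx n s

instance (n s : ℕ) : Fintype (DirVtx n s) := inferInstanceAs (Fintype (Vtx n s))

/-- The subquiver `Q'` of `Q^(n,s)` with the arrows `α_i`, `i ≠ 0`. -/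
instance (n s : ℕ) : Quiver.{0} (DirVtx n s) where
  Hom x y := {a : @Quiver.Hom (Vtx n s) _ x y // a.1 ≠ 0}

namespace Zigzag

variable {n s : ℕ}

/-- The label `i` of an arrow `α_i` of `Q^(n,s)`. -/
def label {x y : Vtx n s} (a : x ⟶ y) : Fin (n + 1) := a.1

/-- The label `i` of an arrow `α_i` of `Q'`. -/
def dirLabel {x y : DirVtx n s} (a : x ⟶ y) : Fin (n + 1) := a.1.1

/-- The vertex of `Q^(n,s)` given by a vertex of `Q'`. -/
def inclVtx (x : DirVtx n s) : Vtx n s := x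

/-- The arrow of `Q^(n,s)` given by an arrow of `Q'`. -/
def inclArrow {x y : DirVtx n s} (a : x ⟶ y) : inclVtx x ⟶ inclVtx y := a.1

/-- The weight `∑ i x_i`, which increases along the arrows of `Q'`. -/
def height (x : DirVtx n s) : ℤ := ∑ j : Fin (n + 1), (j : ℤ) * ((inclVtx x).1 j : ℤ)

theorem height_arrow {x y : DirVtx n s} (a : x ⟶ y) : height x < height y := by
  obtain ⟨⟨i, hi⟩, h0⟩ := a
  have h0 : i ≠ 0 := h0
  have h1 : ((i - 1 : Fin (n + 1)) : ℕ) + 1 = i := by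
    have := Fin.coe_sub_one i
    rw [if_neg h0] at this
    have : (i : ℕ) ≠ 0 := fun h => h0 (Fin.ext h)
    omega
  have : height y = height x + ((i : ℤ) - ((i - 1 : Fin (n + 1)) : ℤ)) := by
    unfold height
    have e : ∀ j, ((inclVtx y).1 j : ℤ) = (inclVtx x).1 j + stepVec i j := hi
    simp only [e, mul_add, Finset.sum_add_distrib, stepVec, Pi.sub_apply, mul_sub,
      Finset.sum_sub_distrib, Pi.single_apply]
    simp
  omega

theorem height_path {x y : DirVtx n s} (p : Quiver.Path x y) : x = y ∨ height x < height y := by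
  induction p with
  | nil => exact Or.inl rfl
  | cons p a ih =>
    rcases ih with rfl | h
    · exact Or.inr (height_arrow a)
    · exact Or.inr (h.trans (height_arrow a))

/-- The partial order on the vertices: `x ≤ y` if there is a path from `x` to `y` that does not
involve any arrow `α_0`. -/
instance : PartialOrder (Vtx n s) where
  le x y := Nonempty (@Quiver.Path (DirVtx n s) _ x y)
  le_refl x := ⟨@Quiver.Path.nil (DirVtx n s) _ x⟩
  le_trans _ _ _ h h' := ⟨h.some.comp h'.some⟩
  le_antisymm x y h h' := by
    rcases height_path h.some with h1 | h1
    · exact h1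
    · rcases height_path h'.some with h2 | h2
      · exact h2.symm
      · exact absurd (h1.trans h2) (lt_irrefl _)

variable (k : Type u) [Field k]

/-- The relations of the higher zigzag-algebra: `α_i α_j = α_j α_i` at a vertex `x` from which both
paths exist, and `α_i α_i = 0`. -/
inductive ZigzagRel (n s : ℕ) : (TwoPath (Vtx n s) →₀ k) → Prop
  | comm {x y y' z : Vtx n s} (a : x ⟶ y) (b : y ⟶ z) (c : x ⟶ y') (d : y' ⟶ z)
      (h : label a = label d) (h' : label b = label c) :
      ZigzagRel n s (Finsupp.single ⟨a, b⟩ 1 - Finsupp.single ⟨c, d⟩ 1)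
  | square {x y z : Vtx n s} (a : x ⟶ y) (b : y ⟶ z) (h : label a = label b) :
      ZigzagRel n s (Finsupp.single ⟨a, b⟩ 1)

/-- The relations of the qh-cover `Γ(Z^n_s)`: those of the higher zigzag-algebra `Z^n_{s+1}`, and
`e_z α_0 α_1 = 0` for the vertices `z` with `z_0 = 0`. -/
inductive CoverRel (n s : ℕ) : (TwoPath (Vtx n (s + 1)) →₀ k) → Prop
  | zigzag (r : TwoPath (Vtx n (s + 1)) →₀ k) (h : ZigzagRel k n (s + 1) r) : CoverRel n s r
  | cut {x y z : Vtx n (s + 1)} (hx : x.1 0 = 0) (a : x ⟶ y) (b : y ⟶ z)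
      (ha : label a = 0) (hb : label b = 1) : CoverRel n s (Finsupp.single ⟨a, b⟩ 1)

/-- The quasi-hereditary cover `Γ(Z^n_s)` of the higher zigzag-algebra `Z^n_s`. -/
abbrev Cover (n s : ℕ) : Type u := QuiverAlg k {r | CoverRel k n s r}

/-- The idempotent `e_x` of the qh-cover. -/
def coverIdem (n s : ℕ) (x : Vtx n (s + 1)) : Cover k n s := QuiverAlg.e k _ x

/-- The arrow `α_i` starting at `x` in the qh-cover. -/
def coverArrow (n s : ℕ) {x y : Vtx n (s + 1)} (a : x ⟶ y) : Cover k n s := QuiverAlg.arrow k _ a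

/-- The subalgebra `B` of `Γ(Z^n_s)` generated by the vertices and the arrows `α_i`, `i ≠ 0`. -/
def borel (n s : ℕ) : Subalgebra k (Cover k n s) :=
  Algebra.adjoin k (Set.range (coverIdem k n s) ∪
    {g | ∃ (x y : Vtx n (s + 1)) (a : x ⟶ y), label a ≠ 0 ∧ g = coverArrow k n s a})

/-- The idempotent `e_x`, as an element of `B`. -/
def borelIdem (n s : ℕ) (x : Vtx n (s + 1)) : borel k n s :=
  ⟨coverIdem k n s x, Algebra.subset_adjoin (Or.inl ⟨x, rfl⟩)⟩

/-- The commutativity and zero relations on `Q'`: `α_i α_j = α_j α_i` if both paths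
exist, and `α_i α_i = 0`. -/
inductive BorelRel (n s : ℕ) : (TwoPath (DirVtx n s) →₀ k) → Prop
  | comm {x y y' z : DirVtx n s} (a : x ⟶ y) (b : y ⟶ z) (c : x ⟶ y') (d : y' ⟶ z)
      (h : dirLabel a = dirLabel d) (h' : dirLabel b = dirLabel c) :
      BorelRel n s (Finsupp.single ⟨a, b⟩ 1 - Finsupp.single ⟨c, d⟩ 1)
  | square {x y z : DirVtx n s} (a : x ⟶ y) (b : y ⟶ z) (h : dirLabel a = dirLabel b) :
      BorelRel n s (Finsupp.single ⟨a, b⟩ 1)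

/-- The relations of the higher Auslander algebra `Λ^(n,s)` of type `A_s`, on the quiver `Q'`:
for a path `α_i α_j` starting at `x`, the relation `α_i α_j = α_j α_i` if `x + f_j` is a vertex,
and `α_i α_j = 0` otherwise. -/
inductive AuslanderRel (n s : ℕ) : (TwoPath (DirVtx n s) →₀ k) → Prop
  | comm {x y y' z : DirVtx n s} (a : x ⟶ y) (b : y ⟶ z) (c : x ⟶ y') (d : y' ⟶ z)
      (h : dirLabel a = dirLabel d) (h' : dirLabel b = dirLabel c) :
      AuslanderRel n s (Finsupp.single ⟨a, b⟩ 1 - Finsupp.single ⟨c, d⟩ 1)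
  | zero {x y z : DirVtx n s} (a : x ⟶ y) (b : y ⟶ z)
      (h : ∀ (y' : DirVtx n s) (c : x ⟶ y'), dirLabel c ≠ dirLabel b) :
      AuslanderRel n s (Finsupp.single ⟨a, b⟩ 1)

end Zigzag

end

/-!
The cover `Γ` is the direct sum `B ⊕ B a₀` of left `B`-modules, where `a₀` is the sum of all arrows
`α_0`, and everything follows from this decomposition.

That `B` and `B a₀` span `Γ` is seen by moving `α_0` to the right: the product `α_0 α_i` is
`α_i α_0` if the latter path exists, the only other nontrivial case is `α_0 α_1` starting at a
vertex `z` with `z_0 = 0`, where the product vanishes, and `α_0 α_0 = 0`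
(`Zigzag.alphaZero_mul_incl_bA`, `Zigzag.exists_eq_incl_add`). That the sum is direct is seen in a
representation of `Γ` by upper triangular `2 × 2` matrices over the bound path algebra of `Q'`
(`Zigzag.toMat`): an arrow of `Q'` acts by itself and by its translate by `-f_0` on the diagonal,
and `α_0` acts by an idempotent in the corner. The entries of the first row are the coordinates with
respect to the decomposition. In particular the bound path algebra of `Q'` embeds into `Γ`.

The consequences are drawn for an abstract `SplitExtension`. The arrows of `Q'` increase the weight
of the vertices, so the bound path algebra is finite-dimensional, triangular, and has a nil
augmentation onto `k^I` (`QuiverAlg.basicAugmentation`); since `B a₀` is an ideal of square zero,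
the same holds for the augmentation of `Γ`. A nil augmentation determines the simple modules, the
radicals of the modules `e_i Γ` and the maximal semisimple subalgebras (`BasicAugmentation`).
If `J` is the radical of `B`, then the kernel of `P_i → Δ_i` is `e_i J Γ`: the
arrows `α_0` do not enlarge it, since they lead to smaller vertices. Hence the induction of a
composition series of `B` is a filtration of `Γ` by standard modules. Exactness of `- ⊗_B Γ` holds
because `M ⊗_B Γ` is naturally a direct summand of `M × M` as an abelian group. The algebra `B` is
the special case `a₀ = 0` of such an extension, and its standard modules are simple.

The quadratic dual of the higher Auslander algebra has the quiver opposite to `Q'` with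
anticommutative squares. Reversing the order of the coordinates identifies the opposite quiver with
`Q'`, and signs that depend on the coordinates of the source turn anticommutative squares into
commutative ones (`Zigzag.arrowSign_mul`, `Zigzag.dualEquiv`).
-/

/-! ### Algebras with a nil augmentation onto a product of copies of the field -/

/-- The algebra `A` is basic with idempotents `e i`: these sum to `1`, and `π` maps `A` onto `k^I`
with nil kernel, taking the `e i` to the coordinate idempotents. -/
structure BasicAugmentation {k A : Type u} [Field k] [Ring A] [Algebra k A] {I : Type} [Fintype I]
    (e : I → A) (π : A →ₐ[k] (I → k)) : Prop where
  idem : ∀ i, e i * e i = e i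
  sum_one : ∑ i, e i = 1
  apply_same : ∀ i, π (e i) i = 1
  apply_ne : ∀ i j, i ≠ j → π (e i) j = 0
  nil : ∀ a, π a = 0 → IsNilpotent a

theorem mem_rightIdeal {A : Type u} [Ring A] {e : A} (he : e * e = e) {a : A} :
    a ∈ rightIdeal e ↔ e * a = a := by
  rw [rightIdeal, Submodule.mem_span_singleton]
  constructor
  · rintro ⟨r, rfl⟩
    rw [← MulOpposite.op_unop r, op_smul_eq_mul, ← mul_assoc, he]
  · intro h
    exact ⟨MulOpposite.op a, by rw [op_smul_eq_mul, h]⟩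

/-- Right multiplication of an element `m` of a right module by the elements of a right ideal. -/
def actHom {A : Type u} [Ring A] (N : Submodule Aᵐᵒᵖ A) {M : Type u} [AddCommGroup M]
    [Module Aᵐᵒᵖ M] (m : M) : N →ₗ[Aᵐᵒᵖ] M where
  toFun a := MulOpposite.op (a : A) • m
  map_add' a b := by simp [add_smul]
  map_smul' r a := by
    rw [← MulOpposite.op_unop r]
    simp [mul_smul]

@[simp]
theorem actHom_apply {A : Type u} [Ring A] (N : Submodule Aᵐᵒᵖ A) {M : Type u} [AddCommGroup M]
    [Module Aᵐᵒᵖ M] (m : M) (a : N) : actHom N m a = MulOpposite.op (a : A) • m := rfl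

namespace BasicAugmentation

/-- The elements of a right ideal that the augmentation kills; for `e i A` this is the radical. -/
def rad {k A : Type u} [Field k] [Ring A] [Algebra k A] {I : Type}
    (π : A →ₐ[k] (I → k)) (N : Submodule Aᵐᵒᵖ A) : Submodule Aᵐᵒᵖ N where
  carrier := {a | π a = 0}
  add_mem' {a b} ha hb := by
    change π (a + b) = 0
    rw [map_add, show π a = 0 from ha, show π b = 0 from hb, add_zero]
  zero_mem' := map_zero π
  smul_mem' r a ha := by
    change π (a * r.unop) = 0
    rw [map_mul, show π a = 0 from ha, zero_mul]

theorem mem_rad {k A : Type u} [Field k] [Ring A] [Algebra k A] {I : Type}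
    {π : A →ₐ[k] (I → k)} {N : Submodule Aᵐᵒᵖ A} {a : N} : a ∈ rad π N ↔ π (a : A) = 0 := Iff.rfl

variable {k A : Type u} [Field k] [Ring A] [Algebra k A] {I : Type} [Fintype I]
  {e : I → A} {π : A →ₐ[k] (I → k)}

theorem apply_eq_zero_iff (h : BasicAugmentation e π) {i : I} {a : A} (ha : e i * a = a) :
    π a = 0 ↔ π a i = 0 := by
  refine ⟨fun H => by rw [H]; rfl, fun H => funext fun j => ?_⟩
  by_cases hij : i = j
  · rw [← hij, H]; rfl
  · rw [← ha, map_mul, Pi.mul_apply, h.apply_ne i j hij, zero_mul]; rfl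

theorem apply_mul (h : BasicAugmentation e π) (i : I) (a : A) : π (e i * a) = 0 ↔ π a i = 0 := by
  rw [h.apply_eq_zero_iff (i := i) (by rw [← mul_assoc, h.idem]), map_mul, Pi.mul_apply,
    h.apply_same, one_mul]

/-- The idempotent `e i` as an element of `e i A`. -/
def gen (e : I → A) (i : I) : rightIdeal (e i) :=
  ⟨e i, Submodule.mem_span_singleton_self _⟩

theorem smul_gen (h : BasicAugmentation e π) {i : I} (a : rightIdeal (e i)) :
    MulOpposite.op (a : A) • gen e i = a :=
  Subtype.ext ((mem_rightIdeal (h.idem i)).1 a.2)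

/-- `e i A` is a local module: an element outside of the radical generates it, because
`e i a e i` differs from a nonzero multiple of `e i` by a nilpotent element. -/
theorem le_rad (h : BasicAugmentation e π) {i : I} {N : Submodule Aᵐᵒᵖ (rightIdeal (e i))}
    (hN : N ≠ ⊤) : N ≤ rad π (rightIdeal (e i)) := by
  intro a ha
  by_contra hπ
  apply hN
  have hea : e i * (a : A) = a := (mem_rightIdeal (h.idem i)).1 a.2
  have hc : π (a : A) i ≠ 0 := fun H => hπ ((h.apply_eq_zero_iff hea).2 H)
  set c := π (a : A) i
  have hj : π ((a : A) * e i - c • e i) = 0 := by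
    refine (h.apply_eq_zero_iff (i := i) ?_).2 ?_
    · rw [mul_sub, ← mul_assoc, hea, mul_smul_comm, h.idem]
    · simp [map_sub, h.apply_same, c]
  have hu : IsUnit (c • (1 : A) + ((a : A) * e i - c • e i)) := by
    have h1 : IsUnit (c • (1 : A)) := by
      rw [← Algebra.algebraMap_eq_smul_one]
      exact (IsUnit.mk0 c hc).map (algebraMap k A)
    refine IsNilpotent.isUnit_add_left_of_commute (h.nil _ hj) h1 ?_
    rw [← Algebra.algebraMap_eq_smul_one]
    exact (Algebra.commutes _ _).symm
  obtain ⟨v, hv⟩ := hu.exists_right_inv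
  have key : (a : A) * (e i * v) = e i := by
    have h1 := congrArg (fun t => e i * t) hv
    simp only [mul_one, ← mul_assoc] at h1
    rwa [mul_add, mul_sub, ← mul_assoc, hea, mul_smul_comm, mul_one, mul_smul_comm, h.idem,
      add_sub_cancel, mul_assoc] at h1
  have hg : gen e i ∈ N := by
    have := N.smul_mem (MulOpposite.op (e i * v)) ha
    convert this using 1
    exact Subtype.ext key.symm
  rw [eq_top_iff]
  intro b _
  rw [← h.smul_gen b]
  exact N.smul_mem _ hg

theorem gen_notMem_rad (h : BasicAugmentation e π) (i : I) :
    gen e i ∉ rad π (rightIdeal (e i)) := fun H => by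
  have : π (e i) i = 0 := by rw [show π (e i) = 0 from H]; rfl
  rw [h.apply_same] at this
  exact one_ne_zero this

theorem isCoatom_rad (h : BasicAugmentation e π) (i : I) :
    IsCoatom (rad π (rightIdeal (e i))) := by
  refine ⟨fun H => h.gen_notMem_rad i (H ▸ Submodule.mem_top), fun N hN => ?_⟩
  by_contra H
  exact hN.not_ge (h.le_rad H)

theorem jacobson_eq (h : BasicAugmentation e π) (i : I) :
    Module.jacobson Aᵐᵒᵖ (rightIdeal (e i)) = rad π (rightIdeal (e i)) :=
  le_antisymm (sInf_le (h.isCoatom_rad i)) (le_sInf fun _ hN => by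
    rw [(hN.le_iff_eq (h.isCoatom_rad i).1).1 (h.le_rad hN.1)])

/-- The class of `e i` in the top of `e i A`. -/
def topGen (e : I → A) (i : I) : topOf (e i) := Submodule.Quotient.mk (gen e i)

theorem smul_topGen_eq_zero (h : BasicAugmentation e π) {i : I} (a : A) :
    MulOpposite.op a • topGen e i = 0 ↔ π a i = 0 := by
  rw [topGen, ← Submodule.Quotient.mk_smul, Submodule.Quotient.mk_eq_zero, h.jacobson_eq,
    mem_rad, ← h.apply_mul]
  rfl

theorem exists_smul_topGen (h : BasicAugmentation e π) {i : I} (t : topOf (e i)) :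
    ∃ a : A, e i * a = a ∧ MulOpposite.op a • topGen e i = t := by
  obtain ⟨b, rfl⟩ := Submodule.Quotient.mk_surjective _ t
  exact ⟨b, (mem_rightIdeal (h.idem i)).1 b.2, by
    rw [topGen, ← Submodule.Quotient.mk_smul, h.smul_gen]⟩

theorem smul_topGen_self (h : BasicAugmentation e π) (i : I) :
    MulOpposite.op (e i) • topGen e i = topGen e i := by
  rw [topGen, ← Submodule.Quotient.mk_smul]
  exact congrArg _ (h.smul_gen (gen e i))

theorem smul_topOf_eq_zero (h : BasicAugmentation e π) {i j : I} (hij : i ≠ j) (t : topOf (e i)) :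
    MulOpposite.op (e j) • t = 0 := by
  obtain ⟨a, ha, rfl⟩ := h.exists_smul_topGen t
  rw [← mul_smul, ← MulOpposite.op_mul, h.smul_topGen_eq_zero, map_mul, Pi.mul_apply,
    h.apply_ne j i hij.symm, mul_zero]

theorem topGen_ne_zero (h : BasicAugmentation e π) (i : I) : topGen e i ≠ 0 := by
  rw [← h.smul_topGen_self i, Ne, h.smul_topGen_eq_zero, h.apply_same]
  exact one_ne_zero

/-- A surjection of `e i A` onto a module with kernel the radical identifies the module with the
top of `e i A`. -/
theorem nonempty_equiv_topOf (h : BasicAugmentation e π) {i : I} {M : Type u} [AddCommGroup M]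
    [Module Aᵐᵒᵖ M] (f : rightIdeal (e i) →ₗ[Aᵐᵒᵖ] M) (hf : Function.Surjective f)
    (hk : LinearMap.ker f = rad π (rightIdeal (e i))) : Nonempty (M ≃ₗ[Aᵐᵒᵖ] topOf (e i)) :=
  ⟨((Submodule.quotEquivOfEq _ _ ((h.jacobson_eq i).trans hk.symm)).trans
    (f.quotKerEquivOfSurjective hf)).symm⟩

theorem exists_smul_ne_zero (h : BasicAugmentation e π) {M : Type u} [AddCommGroup M]
    [Module Aᵐᵒᵖ M] {m : M} (hm : m ≠ 0) : ∃ i, MulOpposite.op (e i) • m ≠ 0 := by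
  by_contra! H
  apply hm
  rw [← one_smul Aᵐᵒᵖ m, ← MulOpposite.op_one, ← h.sum_one]
  rw [← MulOpposite.opAddEquiv_apply, map_sum, Finset.sum_smul]
  exact Finset.sum_eq_zero fun i _ => H i

/-- The idempotents of a basic algebra label its simple modules. -/
theorem labelsSimples (h : BasicAugmentation e π) : LabelsSimples e where
  idem := h.idem
  simple i := by
    rw [isSimpleModule_iff_isCoatom, h.jacobson_eq]
    exact h.isCoatom_rad i
  exhaust S _ _ hS := by
    have := IsSimpleModule.nontrivial Aᵐᵒᵖ S
    obtain ⟨m, hm⟩ := exists_ne (0 : S)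
    obtain ⟨i, hi⟩ := h.exists_smul_ne_zero hm
    refine ⟨i, ?_, ?_⟩
    · set f := actHom (rightIdeal (e i)) m
      have hf : f ≠ 0 := fun H => hi (by simpa [f, gen] using LinearMap.congr_fun H (gen e i))
      have hs : Function.Surjective f := (LinearMap.surjective_or_eq_zero f).resolve_right hf
      refine h.nonempty_equiv_topOf f hs ?_
      have hc : IsCoatom (LinearMap.ker f) := by
        rw [← isSimpleModule_iff_isCoatom]
        exact IsSimpleModule.congr (f.quotKerEquivOfSurjective hs)
      exact ((hc.le_iff_eq (h.isCoatom_rad i).1).1 (h.le_rad hc.1)).symm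
    · rintro j ⟨θ⟩
      by_contra hij
      exact hi (θ.injective (by rw [map_smul, h.smul_topOf_eq_zero hij, map_zero]))

/-- The simple module `top (e j A)` is a composition factor of `M` if and only if `M e j` does not
vanish. -/
theorem hasCompositionFactor_iff (h : BasicAugmentation e π) {M : Type u} [AddCommGroup M]
    [Module Aᵐᵒᵖ M] {j : I} :
    HasCompositionFactor Aᵐᵒᵖ M (topOf (e j)) ↔ ∃ m : M, MulOpposite.op (e j) • m ≠ 0 := by
  constructor
  · rintro ⟨N₁, N₂, -, ⟨θ⟩⟩
    obtain ⟨m, hm⟩ := Submodule.Quotient.mk_surjective _ (θ.symm (topGen e j))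
    refine ⟨m, fun H => h.topGen_ne_zero j (θ.symm.injective ?_)⟩
    rw [map_zero, ← h.smul_topGen_self, map_smul, ← hm, ← Submodule.Quotient.mk_smul,
      show MulOpposite.op (e j) • m = 0 from Subtype.ext H, Submodule.Quotient.mk_zero]
  · rintro ⟨m, hm⟩
    set f := actHom (rightIdeal (e j)) m
    have hf : f (gen e j) ≠ 0 := hm
    refine ⟨(rad π (rightIdeal (e j))).map f, LinearMap.range f, LinearMap.map_le_range, ?_⟩
    refine h.nonempty_equiv_topOf ((Submodule.mkQ _).comp f.rangeRestrict)
      ((Submodule.mkQ_surjective _).comp f.surjective_rangeRestrict) ?_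
    refine le_antisymm (h.le_rad fun H => ?_) fun a ha => ?_
    · have hg : gen e j ∈ LinearMap.ker
          ((Submodule.mkQ (((rad π (rightIdeal (e j))).map f).submoduleOf
            (LinearMap.range f))).comp f.rangeRestrict) := H ▸ Submodule.mem_top
      rw [LinearMap.mem_ker, LinearMap.comp_apply, Submodule.mkQ_apply,
        Submodule.Quotient.mk_eq_zero] at hg
      obtain ⟨b, hb, hbf⟩ : ∃ b ∈ rad π (rightIdeal (e j)), f b = f (gen e j) := hg
      -- The kernel of `f` contains `e j - b`, which lies outside of the radical.
      have h1 : gen e j - b ∈ rad π (rightIdeal (e j)) := by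
        refine h.le_rad (N := LinearMap.ker f) (fun H' => hf ?_) ?_
        · exact LinearMap.mem_ker.1 (H' ▸ Submodule.mem_top)
        · rw [LinearMap.mem_ker, map_sub, hbf, sub_self]
      exact h.gen_notMem_rad j (by simpa using add_mem h1 hb)
    · rw [LinearMap.mem_ker, LinearMap.comp_apply, Submodule.mkQ_apply,
        Submodule.Quotient.mk_eq_zero]
      exact ⟨a, ha, rfl⟩

theorem standardKernel_eq [PartialOrder I] (h : BasicAugmentation e π) {i : I}
    {K : Submodule Aᵐᵒᵖ (rightIdeal (e i))}
    (hK : ∀ j, i < j → ∀ a : rightIdeal (e i), MulOpposite.op (e j) • a ∈ K)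
    (hmin : ∀ N : Submodule Aᵐᵒᵖ (rightIdeal (e i)),
      (∀ j, i < j → ∀ a : rightIdeal (e i), MulOpposite.op (e j) • a ∈ N) → K ≤ N) :
    standardKernel e i = K := by
  refine le_antisymm (sInf_le fun j hj => ?_) (le_sInf fun N hN => hmin N fun j hj a => ?_)
  · rw [h.hasCompositionFactor_iff]
    rintro ⟨m, hm⟩
    obtain ⟨a, rfl⟩ := Submodule.Quotient.mk_surjective _ m
    rw [← Submodule.Quotient.mk_smul, Ne, Submodule.Quotient.mk_eq_zero] at hm
    exact hm (hK j hj a)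
  · have := hN j hj
    rw [h.hasCompositionFactor_iff] at this
    push Not at this
    have := this (Submodule.Quotient.mk a)
    rwa [← Submodule.Quotient.mk_smul, Submodule.Quotient.mk_eq_zero] at this

/-- A semisimple subalgebra that contains the idempotents is maximal semisimple: on a larger semisimple
subalgebra the augmentation is still injective, as its kernel is nil. -/
theorem isMaximalSemisimple (h : BasicAugmentation e π) {C : Subalgebra k A}
    (hC : ∀ i, e i ∈ C) (hss : IsSemisimpleRing C) : IsMaximalSemisimple C := by
  refine ⟨hss, fun D hD hCD d hd => ?_⟩
  replace hD : IsSemisimpleRing D := hD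
  have hker : ∀ x : D, π x = 0 → x = 0 := by
    intro x hx
    have hnil : ∀ y : D, IsNilpotent (y * x) := by
      intro y
      have : π ((y * x : D) : A) = 0 := by
        rw [Subalgebra.coe_mul, map_mul, hx, mul_zero]
      obtain ⟨m, hm⟩ := h.nil _ this
      exact ⟨m, Subtype.ext (by simpa using hm)⟩
    have : x ∈ Ring.jacobson D := by
      rw [← Ideal.jacobson_bot, Ideal.mem_jacobson_iff]
      intro y
      obtain ⟨z, hz⟩ := (hnil y).isUnit_add_one.exists_left_inv
      exact ⟨z, by rw [mul_assoc, ← mul_add_one, hz, sub_self]; exact zero_mem _⟩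
    rwa [IsSemisimpleRing.jacobson_eq_bot] at this
  have hmem : ∑ i, π d i • e i ∈ C := sum_mem fun i _ => C.smul_mem (hC i) _
  have := hker (⟨d, hd⟩ - ⟨∑ i, π d i • e i, hCD hmem⟩) (by
    rw [Subalgebra.coe_sub, map_sub, sub_eq_zero]
    funext j
    simp only [map_sum, map_smul, Finset.sum_apply, Pi.smul_apply, smul_eq_mul]
    rw [Finset.sum_eq_single j (fun i _ hij => by rw [h.apply_ne i j hij, mul_zero])
      (fun H => absurd (Finset.mem_univ j) H), h.apply_same, mul_one])
  rw [sub_eq_zero, Subtype.mk.injEq] at this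
  exact this ▸ hmem

end BasicAugmentation

/-! ### Split extensions of triangular algebras -/

/-- The algebra `Γ` is a direct sum `B ⊕ B a₀` of left `B`-modules, with coordinates `p` and `q`,
over the algebra `B` with idempotents `f i`. The module `B a₀` is isomorphic to `B (q a₀)`.
The algebra `B` is triangular for the order on `I`, and right multiplication by `f j` either kills
`a₀` or amounts to left multiplication by `f j'` for a larger `j'`. -/
structure SplitExtension {k B Γ : Type u} [Field k] [Ring B] [Algebra k B] [Ring Γ] [Algebra k Γ]
    {I : Type} [Fintype I] [PartialOrder I] (ι : B →ₐ[k] Γ) (f : I → B) (π : B →ₐ[k] (I → k))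
    (p q : Γ →ₗ[k] B) (a₀ : Γ) : Prop where
  base : BasicAugmentation f π
  triangular : ∀ i j b, π b = 0 → ¬ i < j → f i * b * f j = 0
  fst_mul : ∀ b l, p (ι b * l) = b * p l
  snd_mul : ∀ b l, q (ι b * l) = b * q l
  fst_one : p 1 = 1
  snd_one : q 1 = 0
  fst_gen : p a₀ = 0
  decomp : ∀ l, ι (p l) + ι (q l) * a₀ = l
  shift : ∀ j, a₀ * ι (f j) = 0 ∨ ∃ j', j < j' ∧ a₀ * ι (f j) = ι (f j') * a₀

namespace SplitExtension

variable {k B Γ : Type u} [Field k] [Ring B] [Algebra k B] [Ring Γ] [Algebra k Γ]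
  {I : Type} [Fintype I] [PartialOrder I] {ι : B →ₐ[k] Γ} {f : I → B} {π : B →ₐ[k] (I → k)}
  {p q : Γ →ₗ[k] B} {a₀ : Γ}

theorem fst_incl (h : SplitExtension ι f π p q a₀) (b : B) : p (ι b) = b := by
  rw [← mul_one (ι b), h.fst_mul, h.fst_one, mul_one]

theorem snd_incl (h : SplitExtension ι f π p q a₀) (b : B) : q (ι b) = 0 := by
  rw [← mul_one (ι b), h.snd_mul, h.snd_one, mul_zero]

theorem snd_eq (h : SplitExtension ι f π p q a₀) (l : Γ) : q l = q l * q a₀ := by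
  conv_lhs => rw [← h.decomp l, map_add, h.snd_incl, h.snd_mul, zero_add]

theorem fst_mul_right (h : SplitExtension ι f π p q a₀) (l l' : Γ) :
    p (l * l') = p l * p l' + q l * p (a₀ * l') := by
  conv_lhs => rw [← h.decomp l, add_mul, map_add, h.fst_mul, mul_assoc, h.fst_mul]

theorem snd_mul_right (h : SplitExtension ι f π p q a₀) (l l' : Γ) :
    q (l * l') = p l * q l' + q l * q (a₀ * l') := by
  conv_lhs => rw [← h.decomp l, add_mul, map_add, h.snd_mul, mul_assoc, h.snd_mul]

theorem fst_mul_idem (h : SplitExtension ι f π p q a₀) (l : Γ) (j : I) :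
    p (l * ι (f j)) = p l * f j := by
  have : p (a₀ * ι (f j)) = 0 := by
    rcases h.shift j with H | ⟨j', -, H⟩
    · rw [H, map_zero]
    · rw [H, h.fst_mul, h.fst_gen, mul_zero]
  rw [h.fst_mul_right, h.fst_incl, this, mul_zero, add_zero]

theorem snd_mul_idem (h : SplitExtension ι f π p q a₀) (l : Γ) {i j : I} (hij : i ≤ j) :
    π (q (l * ι (f j))) i = 0 := by
  rw [h.snd_mul_right, h.snd_incl, mul_zero, zero_add, map_mul, Pi.mul_apply]
  rcases h.shift j with H | ⟨j', hj, H⟩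
  · rw [H, map_zero, map_zero, Pi.zero_apply, mul_zero]
  · rw [H, h.snd_mul, map_mul, Pi.mul_apply, h.base.apply_ne j' i (hij.trans_lt hj).ne', zero_mul,
      mul_zero]

/-- The right ideal `M Γ = M ⊕ M a₀` generated by a right ideal `M` of `B`. -/
def extend (h : SplitExtension ι f π p q a₀) (M : Submodule Bᵐᵒᵖ B) : Submodule Γᵐᵒᵖ Γ where
  carrier := {a | p a ∈ M ∧ q a ∈ M}
  add_mem' {a b} ha hb := by
    simp only [Set.mem_ofPred_eq, map_add]
    exact ⟨add_mem ha.1 hb.1, add_mem ha.2 hb.2⟩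
  zero_mem' := by simp
  smul_mem' r a ha := by
    have hM : ∀ x ∈ M, ∀ b : B, x * b ∈ M := fun x hx b => M.smul_mem (MulOpposite.op b) hx
    change p (a * r.unop) ∈ M ∧ q (a * r.unop) ∈ M
    rw [h.fst_mul_right, h.snd_mul_right]
    exact ⟨add_mem (hM _ ha.1 _) (hM _ ha.2 _), add_mem (hM _ ha.1 _) (hM _ ha.2 _)⟩

theorem mem_extend (h : SplitExtension ι f π p q a₀) {M : Submodule Bᵐᵒᵖ B} {a : Γ} :
    a ∈ h.extend M ↔ p a ∈ M ∧ q a ∈ M := Iff.rfl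

/-- The radical of `B` as a right ideal. -/
def augIdeal (π : B →ₐ[k] (I → k)) : Submodule Bᵐᵒᵖ B where
  carrier := {b | π b = 0}
  add_mem' {a b} ha hb := by
    change π (a + b) = 0
    rw [map_add, show π a = 0 from ha, show π b = 0 from hb, add_zero]
  zero_mem' := map_zero π
  smul_mem' r a ha := by
    change π (a * r.unop) = 0
    rw [map_mul, show π a = 0 from ha, zero_mul]

/-- The kernel of the projection from `P_i` to the standard module `Δ_i`. -/
def stdKer (h : SplitExtension ι f π p q a₀) (i : I) : Submodule Γᵐᵒᵖ (rightIdeal (ι (f i))) :=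
  (h.extend (augIdeal π)).submoduleOf _

theorem mem_stdKer (h : SplitExtension ι f π p q a₀) {i : I} {a : rightIdeal (ι (f i))} :
    a ∈ h.stdKer i ↔ π (p (a : Γ)) = 0 ∧ π (q (a : Γ)) = 0 := Iff.rfl

theorem idem_incl (h : SplitExtension ι f π p q a₀) (i : I) : ι (f i) * ι (f i) = ι (f i) := by
  rw [← map_mul, h.base.idem]

theorem mul_fst (h : SplitExtension ι f π p q a₀) {i : I} (a : rightIdeal (ι (f i))) :
    f i * p (a : Γ) = p a := by
  rw [← h.fst_mul, (mem_rightIdeal (h.idem_incl i)).1 a.2]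

theorem mul_snd (h : SplitExtension ι f π p q a₀) {i : I} (a : rightIdeal (ι (f i))) :
    f i * q (a : Γ) = q a := by
  rw [← h.snd_mul, (mem_rightIdeal (h.idem_incl i)).1 a.2]

theorem mem_stdKer_iff (h : SplitExtension ι f π p q a₀) {i : I} {a : rightIdeal (ι (f i))} :
    a ∈ h.stdKer i ↔ π (p (a : Γ)) i = 0 ∧ π (q (a : Γ)) i = 0 := by
  rw [h.mem_stdKer, h.base.apply_eq_zero_iff (h.mul_fst a), h.base.apply_eq_zero_iff (h.mul_snd a)]

/-- The standard kernel is `f i J Γ` for the radical `J` of `B`: the elements of `f i J` are sums of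
elements of `f i B f j` with `i < j`. -/
theorem standardKernel_eq (h : SplitExtension ι f π p q a₀) {πΓ : Γ →ₐ[k] (I → k)}
    (hΓ : BasicAugmentation (fun i => ι (f i)) πΓ) (i : I) :
    standardKernel (fun i => ι (f i)) i = h.stdKer i := by
  refine hΓ.standardKernel_eq (fun j hj a => ?_) (fun N hN a ha => ?_)
  · rw [h.mem_stdKer_iff]
    change π (p ((a : Γ) * ι (f j))) i = 0 ∧ π (q ((a : Γ) * ι (f j))) i = 0
    refine ⟨?_, h.snd_mul_idem _ hj.le⟩
    rw [h.fst_mul_idem, map_mul, Pi.mul_apply, h.base.apply_ne j i hj.ne', mul_zero]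
  · have hi := hΓ.idem i
    have key : ∀ b : B, π b = 0 → f i * b = b → ∀ l : Γ,
        ∃ x ∈ N, (x : Γ) = ι b * l := by
      intro b hb hbi l
      have hmem : ∀ j, ι b * ι (f j) ∈ rightIdeal (ι (f i)) := fun j => by
        rw [mem_rightIdeal hi, ← mul_assoc, ← map_mul ι (f i), hbi]
      have hmem' : ∀ j, (⟨ι b * ι (f j), hmem j⟩ : rightIdeal (ι (f i))) ∈ N := by
        intro j
        by_cases hij : i < j
        · have hb' : ι b ∈ rightIdeal (ι (f i)) := by
            rw [mem_rightIdeal hi, ← map_mul, hbi]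
          exact hN j hij ⟨ι b, hb'⟩
        · convert N.zero_mem
          rw [← map_mul, ← hbi, h.triangular i j b hb hij, map_zero]
          rfl
      refine ⟨MulOpposite.op l • ∑ j, (⟨ι b * ι (f j), hmem j⟩ : rightIdeal (ι (f i))),
        N.smul_mem _ (sum_mem fun j _ => hmem' j), ?_⟩
      rw [Submodule.coe_smul, AddSubmonoidClass.coe_finsetSum, op_smul_eq_mul]
      simp only [← Finset.mul_sum]
      rw [← map_sum, h.base.sum_one, map_one, mul_one]
    obtain ⟨x, hx, hx'⟩ := key _ (h.mem_stdKer.1 ha).1 (h.mul_fst a) 1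
    obtain ⟨y, hy, hy'⟩ := key _ (h.mem_stdKer.1 ha).2 (h.mul_snd a) a₀
    have : a = x + y := Subtype.ext (by
      rw [Submodule.coe_add, hx', hy', mul_one, h.decomp])
    rw [this]
    exact add_mem hx hy

/-- The endomorphisms of `Δ_i` are scalars: `Δ_i` is generated by the class of `f i`, and
`Δ_i f i` is spanned by this class. -/
theorem nonempty_endStandard (h : SplitExtension ι f π p q a₀) {πΓ : Γ →ₐ[k] (I → k)}
    (hΓ : BasicAugmentation (fun i => ι (f i)) πΓ) (i : I) :
    Nonempty (Module.End Γᵐᵒᵖ (Standard (fun i => ι (f i)) i) ≃ₐ[k] k) := by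
  have hK := h.standardKernel_eq hΓ i
  set e : I → Γ := fun i => ι (f i) with he
  set v : Standard e i := Submodule.Quotient.mk (BasicAugmentation.gen e i) with hv
  have hgen : ∀ w : Standard e i, ∃ l : Γ, w = MulOpposite.op l • v := by
    intro w
    obtain ⟨a, rfl⟩ := Submodule.Quotient.mk_surjective _ w
    exact ⟨a, by rw [hv, ← Submodule.Quotient.mk_smul, hΓ.smul_gen]⟩
  have hve : MulOpposite.op (e i) • v = v := by
    rw [hv, ← Submodule.Quotient.mk_smul]
    exact congrArg _ (hΓ.smul_gen (BasicAugmentation.gen e i))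
  have hv0 : v ≠ 0 := by
    rw [hv, Ne, Submodule.Quotient.mk_eq_zero, hK, h.mem_stdKer_iff]
    rintro ⟨H, -⟩
    change π (p (ι (f i))) i = 0 at H
    rw [h.fst_incl, h.base.apply_same] at H
    exact one_ne_zero H
  have hscal : ∀ w : Standard e i, ∃ c : k, MulOpposite.op (e i) • w = c • v := by
    intro w
    obtain ⟨a, rfl⟩ := Submodule.Quotient.mk_surjective _ w
    refine ⟨π (p (a : Γ)) i, ?_⟩
    rw [hv, ← Submodule.Quotient.mk_smul, ← Submodule.Quotient.mk_smul, ← sub_eq_zero,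
      ← Submodule.Quotient.mk_sub, Submodule.Quotient.mk_eq_zero, hK, h.mem_stdKer_iff]
    change π (p ((a : Γ) * ι (f i) - π (p (a : Γ)) i • ι (f i))) i = 0 ∧
      π (q ((a : Γ) * ι (f i) - π (p (a : Γ)) i • ι (f i))) i = 0
    refine ⟨?_, ?_⟩
    · rw [map_sub, h.fst_mul_idem, map_smul, h.fst_incl]
      simp [h.base.apply_same]
    · rw [map_sub, map_smul, h.snd_incl, smul_zero, sub_zero]
      exact h.snd_mul_idem _ le_rfl
  refine ⟨(AlgEquiv.ofBijective (Algebra.ofId k _) ⟨?_, ?_⟩).symm⟩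
  · have : Nontrivial (Standard e i) := ⟨v, 0, hv0⟩
    exact (algebraMap k (Module.End Γᵐᵒᵖ (Standard e i))).injective
  · intro F
    obtain ⟨c, hc⟩ := hscal (F v)
    refine ⟨c, LinearMap.ext fun w => ?_⟩
    obtain ⟨l, rfl⟩ := hgen w
    have : F v = c • v := by rw [← hc, ← map_smul, hve]
    rw [map_smul]
    exact (congrArg (MulOpposite.op l • ·) this.symm).trans (F.map_smul _ v).symm

/-- If the quotient `M'/M` of right ideals of `B` is the simple module with label `i`, then
`M'Γ/MΓ` is the standard module with label `i`. -/
theorem nonempty_extend_quotient_equiv (h : SplitExtension ι f π p q a₀) {πΓ : Γ →ₐ[k] (I → k)}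
    (hΓ : BasicAugmentation (fun i => ι (f i)) πΓ) {M M' : Submodule Bᵐᵒᵖ B} {i : I}
    (θ : topOf (f i) ≃ₗ[Bᵐᵒᵖ] M' ⧸ M.submoduleOf M') :
    Nonempty ((h.extend M' ⧸ (h.extend M).submoduleOf (h.extend M')) ≃ₗ[Γᵐᵒᵖ]
      Standard (fun i => ι (f i)) i) := by
  obtain ⟨m, hm⟩ := Submodule.Quotient.mk_surjective _ (θ (BasicAugmentation.topGen f i))
  have hmM' : ∀ b : B, (m : B) * b ∈ M' := fun b => M'.smul_mem (MulOpposite.op b) m.2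
  have hmk : ∀ b : B, θ (MulOpposite.op b • BasicAugmentation.topGen f i) =
      Submodule.Quotient.mk (MulOpposite.op b • m) := fun b => by
    rw [map_smul, ← hm, Submodule.Quotient.mk_smul]
  have hzero : ∀ b : B, (m : B) * b ∈ M ↔ π b i = 0 := fun b => by
    rw [← h.base.smul_topGen_eq_zero, ← θ.map_eq_zero_iff, hmk, Submodule.Quotient.mk_eq_zero]
    rfl
  have hsurj : ∀ m' ∈ M', ∃ b, f i * b = b ∧ m' - (m : B) * b ∈ M := by
    intro m' hm'
    obtain ⟨b, hb, hb'⟩ := h.base.exists_smul_topGen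
      (θ.symm (Submodule.Quotient.mk ⟨m', hm'⟩))
    refine ⟨b, hb, ?_⟩
    have := hmk b
    rw [hb', θ.apply_symm_apply, ← sub_eq_zero, ← Submodule.Quotient.mk_sub,
      Submodule.Quotient.mk_eq_zero] at this
    exact this
  let F₀ : rightIdeal (ι (f i)) →ₗ[Γᵐᵒᵖ] h.extend M' :=
    (actHom _ (ι (m : B))).codRestrict _ fun a => by
      rw [actHom_apply, op_smul_eq_mul, h.mem_extend, h.fst_mul, h.snd_mul]
      exact ⟨hmM' _, hmM' _⟩
  let F := (Submodule.mkQ ((h.extend M).submoduleOf (h.extend M'))).comp F₀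
  have hF : ∀ a, ((F₀ a : h.extend M') : Γ) = ι (m : B) * (a : Γ) := fun a => rfl
  have hker : LinearMap.ker F = standardKernel (fun i => ι (f i)) i := by
    rw [h.standardKernel_eq hΓ]
    ext a
    rw [LinearMap.mem_ker, LinearMap.comp_apply, Submodule.mkQ_apply,
      Submodule.Quotient.mk_eq_zero, h.mem_stdKer_iff]
    change ((F₀ a : h.extend M') : Γ) ∈ h.extend M ↔ _
    rw [hF, h.mem_extend, h.fst_mul, h.snd_mul, hzero, hzero]
  have hFs : Function.Surjective F := by
    intro t
    obtain ⟨⟨a, ha⟩, rfl⟩ := Submodule.Quotient.mk_surjective _ t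
    obtain ⟨b, hb, hbM⟩ := hsurj _ (h.mem_extend.1 ha).1
    obtain ⟨c, hc, hcM⟩ := hsurj _ (h.mem_extend.1 ha).2
    have hx : ι b + ι c * a₀ ∈ rightIdeal (ι (f i)) := by
      rw [mem_rightIdeal (h.idem_incl i), mul_add, ← mul_assoc, ← map_mul, ← map_mul, hb, hc]
    refine ⟨⟨_, hx⟩, ?_⟩
    symm
    rw [LinearMap.comp_apply, Submodule.mkQ_apply, ← sub_eq_zero, ← Submodule.Quotient.mk_sub,
      Submodule.Quotient.mk_eq_zero]
    change a - ι (m : B) * (ι b + ι c * a₀) ∈ h.extend M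
    rw [h.mem_extend, map_sub, map_sub, h.fst_mul, h.snd_mul, map_add, map_add, h.fst_incl,
      h.snd_incl, h.fst_mul, h.snd_mul, h.fst_gen, mul_zero, add_zero, zero_add]
    refine ⟨hbM, ?_⟩
    rw [h.snd_eq a, ← mul_assoc, ← sub_mul]
    exact M.smul_mem (MulOpposite.op (q a₀)) hcM
  exact ⟨((Submodule.quotEquivOfEq _ _ hker.symm).trans (F.quotKerEquivOfSurjective hFs)).symm⟩

/-- A composition series of `B` extends to a filtration of `Γ` by standard modules. -/
theorem hasStandardFiltration (h : SplitExtension ι f π p q a₀) {πΓ : Γ →ₐ[k] (I → k)}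
    (hΓ : BasicAugmentation (fun i => ι (f i)) πΓ) [FiniteDimensional k B] :
    HasStandardFiltration (fun i => ι (f i)) := by
  have hfin : IsFiniteLength Bᵐᵒᵖ B := by
    rw [isFiniteLength_iff_isNoetherian_isArtinian]
    exact ⟨isNoetherian_of_tower k inferInstance, isArtinian_of_tower k inferInstance⟩
  obtain ⟨s, hs0, hs1⟩ := isFiniteLength_iff_exists_compositionSeries.1 hfin
  have hs : Monotone s := CompositionSeries.strictMono s |>.monotone
  refine ⟨s.length, fun j => h.extend (s j), ?_, ?_, ?_, fun j => ?_⟩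
  · intro i j hij a ha
    exact ⟨hs hij ha.1, hs hij ha.2⟩
  · rw [eq_bot_iff]
    rintro a ⟨ha, ha'⟩
    rw [show s 0 = ⊥ from hs0, Submodule.mem_bot] at ha ha'
    rw [Submodule.mem_bot, ← h.decomp a, ha, ha', map_zero, zero_mul, add_zero]
  · rw [eq_top_iff]
    intro a _
    change p a ∈ s.last ∧ q a ∈ s.last
    rw [hs1]
    exact ⟨Submodule.mem_top, Submodule.mem_top⟩
  · have hc : s j.castSucc ⋖ s j.succ := s.step j
    have hsimple := (covBy_iff_quot_is_simple hc.le).1 hc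
    obtain ⟨i, ⟨θ⟩, -⟩ := h.base.labelsSimples.exhaust _ hsimple
    exact ⟨i, h.nonempty_extend_quotient_equiv hΓ θ.symm⟩

theorem isQuasiHereditary (h : SplitExtension ι f π p q a₀) {πΓ : Γ →ₐ[k] (I → k)}
    (hΓ : BasicAugmentation (fun i => ι (f i)) πΓ) [FiniteDimensional k B] :
    IsQuasiHereditary k (fun i => ι (f i)) where
  finite := by
    have : Function.Surjective (ι.toLinearMap.coprod
        ((LinearMap.mulRight k a₀).comp ι.toLinearMap)) := fun l => ⟨(p l, q l), h.decomp l⟩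
    exact Module.Finite.of_surjective _ this
  labels := hΓ.labelsSimples
  endo := h.nonempty_endStandard hΓ
  filtration := h.hasStandardFiltration hΓ

/-- If `p` is multiplicative and `a₀² = 0`, then `B a₀` is an ideal of square zero, so that an
augmentation of `B` with nil kernel extends to `Γ`. -/
theorem basicAugmentation (h : SplitExtension ι f π p q a₀) (ρ : Γ →ₐ[k] B) (hρ : ∀ l, ρ l = p l)
    (h0 : a₀ * a₀ = 0) : BasicAugmentation (fun i => ι (f i)) (π.comp ρ) where
  idem := h.idem_incl
  sum_one := by rw [← map_sum, h.base.sum_one, map_one]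
  apply_same i := by rw [AlgHom.comp_apply, hρ, h.fst_incl, h.base.apply_same]
  apply_ne i j hij := by rw [AlgHom.comp_apply, hρ, h.fst_incl, h.base.apply_ne i j hij]
  nil a ha := by
    have hsq : ∀ l, ρ l = 0 → l * l = 0 := by
      intro l hl
      have hl' : ∀ l, ρ l = 0 → ι (q l) * a₀ = l := fun l hl => by
        conv_rhs => rw [← h.decomp l, ← hρ, hl, map_zero, zero_add]
      have h1 : ρ (a₀ * ι (q l)) = 0 := by rw [map_mul, hρ a₀, h.fst_gen, zero_mul]
      rw [← hl' l hl, mul_assoc, ← mul_assoc a₀, ← hl' _ h1, mul_assoc, h0, mul_zero, mul_zero]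
    obtain ⟨m, hm⟩ := h.base.nil _ ha
    exact ⟨m + m, by rw [pow_add, hsq _ ((map_pow ρ a m).trans hm)]⟩

theorem congr (h : SplitExtension ι f π p q a₀) {B' : Type u} [Ring B'] [Algebra k B']
    (Φ : B ≃ₐ[k] B') (ι' : B' →ₐ[k] Γ) (hι : ∀ b, ι' (Φ b) = ι b) :
    SplitExtension ι' (fun i => Φ (f i)) (π.comp (Φ.symm : B' →ₐ[k] B))
      (Φ.toLinearMap.comp p) (Φ.toLinearMap.comp q) a₀ where
  base :=
    { idem := fun i => by rw [← map_mul, h.base.idem]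
      sum_one := by rw [← map_sum, h.base.sum_one, map_one]
      apply_same := fun i => by simpa using h.base.apply_same i
      apply_ne := fun i j hij => by simpa using h.base.apply_ne i j hij
      nil := fun a ha => by
        simpa using (h.base.nil _ ha).map Φ }
  triangular i j b hb hij := by
    obtain ⟨b, rfl⟩ := Φ.surjective b
    rw [← map_mul, ← map_mul, h.triangular i j b (by simpa using hb) hij, map_zero]
  fst_mul b l := by
    obtain ⟨b, rfl⟩ := Φ.surjective b
    simp [hι, h.fst_mul]
  snd_mul b l := by
    obtain ⟨b, rfl⟩ := Φ.surjective b
    simp [hι, h.snd_mul]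
  fst_one := by simp [h.fst_one]
  snd_one := by simp [h.snd_one]
  fst_gen := by simp [h.fst_gen]
  decomp l := by simpa [hι] using h.decomp l
  shift j := by simpa only [hι] using h.shift j

/-- A triangular basic algebra is the trivial extension of itself, with `a₀ = 0`. -/
theorem refl {f : I → B} {π : B →ₐ[k] (I → k)} (hb : BasicAugmentation f π)
    (ht : ∀ i j b, π b = 0 → ¬ i < j → f i * b * f j = 0) :
    SplitExtension (AlgHom.id k B) f π LinearMap.id 0 0 where
  base := hb
  triangular := ht
  fst_mul _ _ := rfl
  snd_mul _ _ := (mul_zero _).symm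
  fst_one := rfl
  snd_one := rfl
  fst_gen := rfl
  decomp l := by simp
  shift j := Or.inl (zero_mul _)

theorem isDirectedAlgebra (h : SplitExtension ι f π p q a₀) [FiniteDimensional k B] :
    IsDirectedAlgebra k f where
  quasiHereditary := (refl h.base h.triangular).isQuasiHereditary h.base
  simple i := by
    have hr := refl h.base h.triangular
    have : standardKernel f i = BasicAugmentation.rad π (rightIdeal (f i)) := by
      refine (hr.standardKernel_eq h.base i).trans ?_
      exact Submodule.ext fun a => ⟨fun H => H.1, fun H => ⟨H, map_zero π⟩⟩
    rw [isSimpleModule_iff_isCoatom, this]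
    exact h.base.isCoatom_rad i

end SplitExtension

/-! ### Induction along a split extension -/

section Induction

variable {k : Type u} [Field k] {Γ : Type u} [Ring Γ] [Algebra k Γ] {B : Subalgebra k Γ}

/-- The class of `l ⊗ m` in the induced module `M ⊗_B Γ`. -/
def Induced.tmul (B : Subalgebra k Γ) {M : Type u} [AddCommGroup M] [Module Bᵐᵒᵖ M] (l : Γ)
    (m : M) : Induced B M :=
  Submodule.Quotient.mk (l ⊗ₜ[ℤ] m)

namespace Induced

variable {M N : Type u} [AddCommGroup M] [Module Bᵐᵒᵖ M] [AddCommGroup N] [Module Bᵐᵒᵖ N]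

theorem add_tmul (l l' : Γ) (m : M) : tmul B (l + l') m = tmul B l m + tmul B l' m := by
  simp [tmul, TensorProduct.add_tmul]

theorem tmul_add (l : Γ) (m m' : M) : tmul B l (m + m') = tmul B l m + tmul B l m' := by
  simp [tmul, TensorProduct.tmul_add]

theorem tmul_zero (l : Γ) : tmul B l (0 : M) = 0 := by
  simp [tmul]

theorem smul_tmul (b : B) (l : Γ) (m : M) :
    tmul B l (MulOpposite.op b • m) = tmul B ((b : Γ) * l) m := by
  rw [tmul, tmul, ← sub_eq_zero, ← Submodule.Quotient.mk_sub, Submodule.Quotient.mk_eq_zero]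
  exact Submodule.subset_span ⟨l, b, m, rfl⟩

theorem op_smul_tmul (c l : Γ) (m : M) :
    MulOpposite.op c • tmul B l m = tmul B (l * c) m := rfl

theorem induction_on {P : Induced B M → Prop} (t : Induced B M) (zero : P 0)
    (tmul : ∀ l m, P (tmul B l m)) (add : ∀ x y, P x → P y → P (x + y)) : P t := by
  obtain ⟨t, rfl⟩ := Submodule.Quotient.mk_surjective _ t
  induction t using TensorProduct.induction_on with
  | zero => exact zero
  | tmul l m => exact tmul l m
  | add x y hx hy => exact add _ _ hx hy

theorem map_tmul (g : M →ₗ[Bᵐᵒᵖ] N) (l : Γ) (m : M) :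
    inducedMap B g (tmul B l m) = tmul B l (g m) := rfl

/-- The additive map `l ⊗ m ↦ m (r l)` given by a map `r : Γ → B`. -/
def coordTensor (r : Γ →ₗ[k] B) (M : Type u) [AddCommGroup M] [Module Bᵐᵒᵖ M] :
    Γ ⊗[ℤ] M →+ M :=
  TensorProduct.liftAddHom
    { toFun := fun l =>
        { toFun := fun m => MulOpposite.op (r l) • m
          map_zero' := smul_zero _
          map_add' := smul_add _ }
      map_zero' := by ext; simp
      map_add' := fun l l' => by ext; simp [add_smul] }
    (fun z l m => by
      change MulOpposite.op (r (z • l)) • m = MulOpposite.op (r l) • z • m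
      rw [map_zsmul, MulOpposite.op_smul, smul_assoc]
      exact (smul_comm _ _ _))

theorem coordTensor_tmul (r : Γ →ₗ[k] B) (l : Γ) (m : M) :
    coordTensor r M (l ⊗ₜ m) = MulOpposite.op (r l) • m := rfl

/-- A left `B`-linear map `r : Γ → B` induces an additive map `M ⊗_B Γ → M`. -/
def coord (r : Γ →ₗ[k] B) (hr : ∀ (b : B) l, r (B.val b * l) = b * r l) (M : Type u)
    [AddCommGroup M] [Module Bᵐᵒᵖ M] : Induced B M →+ M :=
  QuotientAddGroup.lift (balancing B M).toAddSubgroup (coordTensor r M) (by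
    intro t ht
    rw [AddMonoidHom.mem_ker]
    -- The kernel of the additive map need not be a submodule, so all translates are considered.
    suffices H : ∀ c : Γᵐᵒᵖ, coordTensor r M (c • t) = 0 by simpa using H 1
    refine Submodule.span_induction (p := fun t _ => ∀ c : Γᵐᵒᵖ, coordTensor r M (c • t) = 0)
      ?_ ?_ ?_ ?_ ht
    · rintro _ ⟨l, b, m, rfl⟩ c
      rw [smul_sub, map_sub, sub_eq_zero, TensorProduct.smul_tmul', TensorProduct.smul_tmul',
        coordTensor_tmul, coordTensor_tmul]
      change MulOpposite.op (r (l * c.unop)) • MulOpposite.op b • m =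
        MulOpposite.op (r (B.val b * l * c.unop)) • m
      rw [mul_assoc, hr, MulOpposite.op_mul, mul_smul]
    · simp
    · intro x y _ _ hx hy c
      rw [smul_add, map_add, hx, hy, add_zero]
    · intro a x _ hx c
      rw [smul_smul]
      exact hx _)

theorem coord_tmul (r : Γ →ₗ[k] B) (hr : ∀ (b : B) l, r (B.val b * l) = b * r l) (l : Γ) (m : M) :
    coord r hr M (tmul B l m) = MulOpposite.op (r l) • m := rfl

theorem coord_map (r : Γ →ₗ[k] B) (hr : ∀ (b : B) l, r (B.val b * l) = b * r l)
    (g : M →ₗ[Bᵐᵒᵖ] N) (t : Induced B M) :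
    coord r hr N (inducedMap B g t) = g (coord r hr M t) := by
  induction t using induction_on with
  | zero => simp
  | tmul l m => rw [map_tmul, coord_tmul, coord_tmul, map_smul]
  | add x y hx hy => simp only [map_add, hx, hy]

end Induced

namespace SplitExtension

variable {I : Type} [Fintype I] [PartialOrder I] {f : I → B} {π : B →ₐ[k] (I → k)}
  {p q : Γ →ₗ[k] B} {a₀ : Γ}

theorem tmul_coord (h : SplitExtension B.val f π p q a₀) {M : Type u} [AddCommGroup M]
    [Module Bᵐᵒᵖ M] (t : Induced B M) :
    Induced.tmul B 1 (Induced.coord p h.fst_mul M t) +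
      Induced.tmul B a₀ (Induced.coord q h.snd_mul M t) = t := by
  induction t using Induced.induction_on with
  | zero => simp [Induced.tmul_zero]
  | tmul l m =>
    rw [Induced.coord_tmul, Induced.coord_tmul, Induced.smul_tmul, Induced.smul_tmul,
      ← Induced.add_tmul, mul_one]
    exact congrArg (Induced.tmul B · m) (h.decomp l)
  | add x y hx hy =>
    conv_rhs => rw [← hx, ← hy]
    simp only [map_add, Induced.tmul_add]
    abel

/-- As an abelian group, `M ⊗_B Γ` is naturally a direct summand of `M × M`; so induction is
exact. -/
theorem inductionExact (h : SplitExtension B.val f π p q a₀) : InductionExact B := by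
  intro L M N _ _ _ _ _ _ f₁ g₁ hfg t
  constructor
  · intro ht
    have h1 : g₁ (Induced.coord p h.fst_mul M t) = 0 := by
      rw [← Induced.coord_map, ht, map_zero]
    have h2 : g₁ (Induced.coord q h.snd_mul M t) = 0 := by
      rw [← Induced.coord_map, ht, map_zero]
    obtain ⟨x, hx⟩ := (hfg _).1 h1
    obtain ⟨y, hy⟩ := (hfg _).1 h2
    refine ⟨Induced.tmul B 1 x + Induced.tmul B a₀ y, ?_⟩
    rw [map_add, Induced.map_tmul, Induced.map_tmul, hx, hy, h.tmul_coord]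
  · rintro ⟨s, rfl⟩
    induction s using Induced.induction_on with
    | zero => simp
    | tmul l m =>
      rw [Induced.map_tmul, Induced.map_tmul, (hfg _).2 ⟨m, rfl⟩, Induced.tmul_zero]
    | add x y hx hy => rw [map_add, map_add, hx, hy, add_zero]

/-- Induction takes the simple `B`-module with label `i` to the standard module `Δ_i`. -/
theorem nonempty_induced_equiv (h : SplitExtension B.val f π p q a₀) {πΓ : Γ →ₐ[k] (I → k)}
    (hΓ : BasicAugmentation (fun i => B.val (f i)) πΓ) (i : I) :
    Nonempty (Induced B (topOf (f i)) ≃ₗ[Γᵐᵒᵖ] Standard (fun i => B.val (f i)) i) := by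
  let F : rightIdeal (B.val (f i)) →ₗ[Γᵐᵒᵖ] Induced B (topOf (f i)) :=
    actHom _ (Induced.tmul B 1 (BasicAugmentation.topGen f i))
  have hF : ∀ a, F a = Induced.tmul B (a : Γ) (BasicAugmentation.topGen f i) := fun a => by
    rw [actHom_apply, Induced.op_smul_tmul, one_mul]
  have hker : LinearMap.ker F = standardKernel (fun i => B.val (f i)) i := by
    rw [h.standardKernel_eq hΓ]
    refine Submodule.ext fun a => ?_
    rw [LinearMap.mem_ker, h.mem_stdKer_iff, ← h.base.smul_topGen_eq_zero,
      ← h.base.smul_topGen_eq_zero, hF]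
    constructor
    · intro H
      rw [← Induced.coord_tmul p h.fst_mul, ← Induced.coord_tmul q h.snd_mul, H, map_zero,
        map_zero]
      exact ⟨rfl, rfl⟩
    · rintro ⟨h1, h2⟩
      rw [← h.tmul_coord (Induced.tmul B _ _), Induced.coord_tmul, Induced.coord_tmul, h1, h2,
        Induced.tmul_zero, Induced.tmul_zero, add_zero]
  have hFs : Function.Surjective F := by
    intro t
    induction t using Induced.induction_on with
    | zero => exact ⟨0, map_zero F⟩
    | tmul l m =>
      obtain ⟨b, hb, rfl⟩ := h.base.exists_smul_topGen m
      have hmem : (b : Γ) * l ∈ rightIdeal (B.val (f i)) := by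
        rw [mem_rightIdeal (h.idem_incl i), ← mul_assoc]
        exact congrArg (fun x : B => (x : Γ) * l) hb
      exact ⟨⟨_, hmem⟩, by rw [hF, Induced.smul_tmul]⟩
    | add x y hx hy =>
      obtain ⟨a, rfl⟩ := hx
      obtain ⟨b, rfl⟩ := hy
      exact ⟨a + b, map_add F a b⟩
  exact ⟨((Submodule.quotEquivOfEq _ _ hker.symm).trans (F.quotKerEquivOfSurjective hFs)).symm⟩

/-- The span of the idempotents is a common maximal semisimple subalgebra of `B` and `Γ`. -/
theorem isStrongExactBorel (h : SplitExtension B.val f π p q a₀) {πΓ : Γ →ₐ[k] (I → k)}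
    (hΓ : BasicAugmentation (fun i => B.val (f i)) πΓ) (horth : ∀ i j, i ≠ j → f i * f j = 0)
    [FiniteDimensional k B] : IsStrongExactBorel B (fun i => B.val (f i)) f where
  exactBorel :=
    { quasiHereditary := h.isQuasiHereditary hΓ
      directed := h.isDirectedAlgebra
      exact := h.inductionExact
      standard := h.nonempty_induced_equiv hΓ }
  strong := by
    classical
    let σ : (I → k) →ₐ[k] B := AlgHom.ofLinearMap (Fintype.linearCombination k f)
      (by simp [Fintype.linearCombination_apply, h.base.sum_one])
      (fun x y => by
        simp only [Fintype.linearCombination_apply, Finset.sum_mul_sum, Pi.mul_apply]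
        refine Finset.sum_congr rfl fun i _ => ?_
        rw [Finset.sum_eq_single i (fun j _ hj => by
          rw [smul_mul_smul_comm, horth i j hj.symm, smul_zero])
          (fun H => absurd (Finset.mem_univ i) H), smul_mul_smul_comm, h.base.idem])
    have hσ : ∀ i, σ (Pi.single i 1) = f i := fun i => by
      change Fintype.linearCombination k f _ = _
      simp
    have hss : IsSemisimpleRing σ.range :=
      σ.rangeRestrict.toRingHom.isSemisimpleRing_of_surjective σ.rangeRestrict_surjective
    have hss' : IsSemisimpleRing (σ.range.map B.val) := by
      rw [← AlgHom.range_comp]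
      exact (B.val.comp σ).rangeRestrict.toRingHom.isSemisimpleRing_of_surjective
        (B.val.comp σ).rangeRestrict_surjective
    exact ⟨σ.range, h.base.isMaximalSemisimple (fun i => ⟨_, hσ i⟩) hss,
      hΓ.isMaximalSemisimple (fun i => ⟨f i, ⟨_, hσ i⟩, rfl⟩) hss'⟩

end SplitExtension

end Induction

/-! ### Bound quiver algebras -/

namespace QuiverAlg

variable {k : Type u} [Field k] {V : Type} [Quiver.{0} V] [Fintype V]
  {R : Set (TwoPath V →₀ k)}

/-- The projection from the free algebra on the vertices and the arrows. -/
def mk (R : Set (TwoPath V →₀ k)) : PreAlg k V →ₐ[k] QuiverAlg k R :=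
  RingQuot.mkAlgHom k (BoundRel k R)

theorem mk_surjective (R : Set (TwoPath V →₀ k)) : Function.Surjective (mk R) :=
  RingQuot.mkAlgHom_surjective k _

theorem mk_rel {a b : PreAlg k V} (h : BoundRel k R a b) : mk R a = mk R b :=
  RingQuot.mkAlgHom_rel k h

theorem mk_vertex (x : V) : mk R (PreAlg.vertex k x) = e k R x := rfl

theorem mk_arrow {x y : V} (a : x ⟶ y) : mk R (PreAlg.arrow k a) = arrow k R a := rfl

theorem e_mul_e (x : V) : e k R x * e k R x = e k R x := by
  rw [← mk_vertex, ← map_mul, mk_rel (BoundRel.idem x)]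

theorem e_mul_e_of_ne {x y : V} (h : x ≠ y) : e k R x * e k R y = 0 := by
  rw [← mk_vertex, ← mk_vertex, ← map_mul, mk_rel (BoundRel.orth x y h), map_zero]

theorem sum_e : ∑ x, e k R x = 1 := by
  simp_rw [← mk_vertex]
  rw [← map_sum, mk_rel BoundRel.one, map_one]

theorem e_mul_arrow {x y : V} (a : x ⟶ y) : e k R x * arrow k R a = arrow k R a := by
  rw [← mk_vertex, ← mk_arrow, ← map_mul, mk_rel (BoundRel.source a)]

theorem arrow_mul_e {x y : V} (a : x ⟶ y) : arrow k R a * e k R y = arrow k R a := by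
  rw [← mk_vertex, ← mk_arrow, ← map_mul, mk_rel (BoundRel.target a)]

theorem e_mul_arrow_of_ne {x y z : V} (h : z ≠ x) (a : x ⟶ y) : e k R z * arrow k R a = 0 := by
  rw [← e_mul_arrow, ← mul_assoc, e_mul_e_of_ne h, zero_mul]

theorem arrow_mul_e_of_ne {x y z : V} (h : y ≠ z) (a : x ⟶ y) : arrow k R a * e k R z = 0 := by
  rw [← arrow_mul_e, mul_assoc, e_mul_e_of_ne h, mul_zero]

theorem sum_arrow_mul_arrow {r : TwoPath V →₀ k} (h : r ∈ R) :
    (r.sum fun p c => c • (arrow k R p.a * arrow k R p.b)) = 0 := by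
  have := mk_rel (BoundRel.rel r h)
  rw [map_zero, Finsupp.sum, map_sum] at this
  simpa only [map_smul, map_mul, mk_arrow, Finsupp.sum] using this

theorem arrow_mul_arrow_eq_zero {x y z : V} {a : x ⟶ y} {b : y ⟶ z}
    (h : Finsupp.single ⟨a, b⟩ 1 ∈ R) : arrow k R a * arrow k R b = 0 := by
  have := sum_arrow_mul_arrow h
  rwa [Finsupp.sum_single_index (by rw [zero_smul]), one_smul] at this

theorem arrow_mul_arrow_eq {x y y' z : V} {a : x ⟶ y} {b : y ⟶ z} {c : x ⟶ y'} {d : y' ⟶ z}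
    (h : Finsupp.single ⟨a, b⟩ 1 - Finsupp.single ⟨c, d⟩ 1 ∈ R) :
    arrow k R a * arrow k R b = arrow k R c * arrow k R d := by
  have := sum_arrow_mul_arrow h
  rwa [Finsupp.sum_sub_index (fun _ _ _ => sub_smul _ _ _),
    Finsupp.sum_single_index (by rw [zero_smul]), Finsupp.sum_single_index (by rw [zero_smul]),
    one_smul, one_smul, sub_eq_zero] at this

section Lift

variable {T : Type u} [Ring T] [Algebra k T]

/-- The homomorphism from a bound quiver algebra given by the images of vertices and arrows. -/
def lift (ε : V → T) (α : ∀ ⦃x y : V⦄, (x ⟶ y) → T) (idem : ∀ x, ε x * ε x = ε x)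
    (orth : ∀ x y, x ≠ y → ε x * ε y = 0) (one : ∑ x, ε x = 1)
    (source : ∀ ⦃x y : V⦄ (a : x ⟶ y), ε x * α a = α a)
    (target : ∀ ⦃x y : V⦄ (a : x ⟶ y), α a * ε y = α a)
    (rel : ∀ r ∈ R, (r.sum fun p c => c • (α p.a * α p.b)) = 0) : QuiverAlg k R →ₐ[k] T :=
  RingQuot.liftAlgHom k
    ⟨FreeAlgebra.lift k (Sum.elim ε fun t => α t.hom), by
      intro a b hab
      induction hab with
      | idem x => simpa [PreAlg.vertex] using idem x
      | orth x y h => simpa [PreAlg.vertex] using orth x y h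
      | one => simpa [PreAlg.vertex] using one
      | source a => simpa [PreAlg.vertex, PreAlg.arrow] using source a
      | target a => simpa [PreAlg.vertex, PreAlg.arrow] using target a
      | rel r h => simpa [PreAlg.arrow, Finsupp.sum] using rel r h⟩

variable {ε : V → T} {α : ∀ ⦃x y : V⦄, (x ⟶ y) → T} {idem : ∀ x, ε x * ε x = ε x}
    {orth : ∀ x y, x ≠ y → ε x * ε y = 0} {one : ∑ x, ε x = 1}
    {source : ∀ ⦃x y : V⦄ (a : x ⟶ y), ε x * α a = α a}
    {target : ∀ ⦃x y : V⦄ (a : x ⟶ y), α a * ε y = α a}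
    {rel : ∀ r ∈ R, (r.sum fun p c => c • (α p.a * α p.b)) = 0}

@[simp]
theorem lift_e (x : V) : lift ε α idem orth one source target rel (e k R x) = ε x := by
  refine (RingQuot.liftAlgHom_mkAlgHom_apply k _ _ _).trans ?_
  simp [PreAlg.vertex]

@[simp]
theorem lift_arrow {x y : V} (a : x ⟶ y) :
    lift ε α idem orth one source target rel (arrow k R a) = α a := by
  refine (RingQuot.liftAlgHom_mkAlgHom_apply k _ _ _).trans ?_
  simp [PreAlg.arrow]

end Lift

theorem adjoin_eq_top : Algebra.adjoin k
    (Set.range (e k R) ∪ {g | ∃ (x y : V) (a : x ⟶ y), g = arrow k R a}) = ⊤ := by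
  have h := congrArg (Subalgebra.map (mk R))
    (FreeAlgebra.adjoin_range_ι k (V ⊕ Quiver.Total V))
  rw [AlgHom.map_adjoin, Algebra.map_top,
    (AlgHom.range_eq_top _).2 (mk_surjective R)] at h
  refine top_le_iff.1 (h.symm.le.trans (Algebra.adjoin_mono ?_))
  rintro _ ⟨_, ⟨x | ⟨x, y, a⟩, rfl⟩, rfl⟩
  · exact Or.inl ⟨x, rfl⟩
  · exact Or.inr ⟨x, y, a, rfl⟩

theorem algHom_ext {T : Type u} [Ring T] [Algebra k T] {f g : QuiverAlg k R →ₐ[k] T}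
    (he : ∀ x, f (e k R x) = g (e k R x))
    (ha : ∀ (x y : V) (a : x ⟶ y), f (arrow k R a) = g (arrow k R a)) : f = g := by
  refine AlgHom.ext_of_adjoin_eq_top adjoin_eq_top ?_
  rintro _ (⟨x, rfl⟩ | ⟨x, y, a, rfl⟩)
  · exact he x
  · exact ha x y a

/-- A linear condition that holds for `1` and is stable under right multiplication by vertices and
arrows holds on the whole algebra. -/
theorem mem_of_mul_mem (S : Submodule k (QuiverAlg k R)) (one : 1 ∈ S)
    (mul_e : ∀ l ∈ S, ∀ x, l * e k R x ∈ S)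
    (mul_arrow : ∀ l ∈ S, ∀ (x y : V) (a : x ⟶ y), l * arrow k R a ∈ S) (l : QuiverAlg k R) :
    l ∈ S := by
  have h : ∀ g : QuiverAlg k R, ∀ l ∈ S, l * g ∈ S := fun g => by
    have hg : g ∈ Algebra.adjoin k
      (Set.range (e k R) ∪ {g | ∃ (x y : V) (a : x ⟶ y), g = arrow k R a}) :=
      adjoin_eq_top (R := R) ▸ Algebra.mem_top
    induction hg using Algebra.adjoin_induction with
    | mem g hg =>
      rcases hg with ⟨x, rfl⟩ | ⟨x, y, a, rfl⟩
      · exact fun l hl => mul_e l hl x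
      · exact fun l hl => mul_arrow l hl x y a
    | algebraMap c =>
      intro l hl
      rw [← Algebra.commutes, ← Algebra.smul_def]
      exact S.smul_mem c hl
    | add g g' _ _ hg hg' =>
      intro l hl
      rw [mul_add]
      exact add_mem (hg l hl) (hg' l hl)
    | mul g g' _ _ hg hg' =>
      intro l hl
      rw [← mul_assoc]
      exact hg' _ (hg l hl)
  simpa using h l 1 one

open Classical in
/-- The augmentation, which kills all arrows. -/
noncomputable def aug (R : Set (TwoPath V →₀ k)) : QuiverAlg k R →ₐ[k] (V → k) :=
  lift (fun x => Pi.single x 1) (fun _ _ _ => 0) (fun x => by simp [← Pi.single_mul])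
    (fun x y h => by
      funext z
      by_cases hz : z = x
      · subst hz; simp [Pi.single_eq_of_ne h]
      · simp [Pi.single_eq_of_ne hz])
    (by funext z; simp [Finset.sum_apply, Pi.single_apply])
    (fun _ _ _ => mul_zero _) (fun _ _ _ => zero_mul _)
    (fun r _ => by simp [Finsupp.sum])

theorem aug_e_self (x : V) : aug R (e k R x) x = 1 := by
  classical
  simp [aug]

theorem aug_e_of_ne {x y : V} (h : x ≠ y) : aug R (e k R x) y = 0 := by
  classical
  simp [aug, h.symm]

theorem aug_arrow {x y : V} (a : x ⟶ y) : aug R (arrow k R a) = 0 := by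
  rw [aug, lift_arrow]

theorem mul_eq_sum (a b : QuiverAlg k R) : a * b = ∑ x, a * e k R x * (e k R x * b) := by
  simp_rw [mul_assoc, ← mul_assoc (e k R _) (e k R _) b, e_mul_e]
  rw [← Finset.mul_sum, ← Finset.sum_mul, sum_e, one_mul]

/-- If the arrows of the quiver increase a strict order, then the bound quiver algebra is
triangular, and its diagonal entries are given by the augmentation. -/
theorem e_mul_mul_e (r : V → V → Prop) (trans : ∀ x y z, r x y → r y z → r x z)
    (hr : ∀ x y : V, (x ⟶ y) → r x y) (a : QuiverAlg k R) :
    (∀ i j, ¬ r i j → i ≠ j → e k R i * a * e k R j = 0) ∧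
      ∀ i, ¬ r i i → e k R i * a * e k R i = aug R a i • e k R i := by
  let S : Submodule k (QuiverAlg k R) :=
    { carrier := {a | (∀ i j, ¬ r i j → i ≠ j → e k R i * a * e k R j = 0) ∧
        ∀ i, ¬ r i i → e k R i * a * e k R i = aug R a i • e k R i}
      add_mem' := fun {a b} ha hb => by
        refine ⟨fun i j h h' => ?_, fun i h => ?_⟩
        · rw [mul_add, add_mul, ha.1 i j h h', hb.1 i j h h', add_zero]
        · rw [mul_add, add_mul, ha.2 i h, hb.2 i h, map_add, Pi.add_apply, add_smul]
      zero_mem' := by simp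
      smul_mem' := fun c a ha => by
        refine ⟨fun i j h h' => ?_, fun i h => ?_⟩
        · rw [mul_smul_comm, smul_mul_assoc, ha.1 i j h h', smul_zero]
        · rw [mul_smul_comm, smul_mul_assoc, ha.2 i h, map_smul, Pi.smul_apply, smul_assoc] }
  refine mem_of_mul_mem S ⟨fun i j _ h => ?_, fun i _ => ?_⟩ (fun a ha x => ?_)
    (fun a ha x y g => ?_) a
  · rw [mul_one, e_mul_e_of_ne h]
  · rw [mul_one, e_mul_e, map_one, Pi.one_apply, one_smul]
  · refine ⟨fun i j h h' => ?_, fun i h => ?_⟩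
    · by_cases hx : x = j
      · rw [hx, mul_assoc, mul_assoc, e_mul_e, ← mul_assoc, ha.1 i j h h']
      · rw [mul_assoc, mul_assoc, e_mul_e_of_ne hx, mul_zero, mul_zero]
    · by_cases hx : x = i
      · rw [hx, mul_assoc, mul_assoc, e_mul_e, ← mul_assoc, ha.2 i h, map_mul, Pi.mul_apply,
          aug_e_self, mul_one]
      · rw [mul_assoc, mul_assoc, e_mul_e_of_ne hx, mul_zero, mul_zero, map_mul, Pi.mul_apply,
          aug_e_of_ne hx, mul_zero, zero_smul]
  · have key : ∀ i j, ¬ r i j → e k R i * (a * arrow k R g) * e k R j = 0 := by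
      intro i j h
      by_cases hy : y = j
      · subst hy
        have h1 : ¬ r i x := fun H => h (trans _ _ _ H (hr _ _ g))
        have h2 : i ≠ x := fun H => h (H ▸ hr _ _ g)
        rw [← e_mul_arrow, ← mul_assoc, ← mul_assoc, ha.1 i x h1 h2, zero_mul, zero_mul]
      · rw [mul_assoc, mul_assoc, arrow_mul_e_of_ne hy, mul_zero, mul_zero]
    refine ⟨fun i j h _ => key i j h, fun i h => ?_⟩
    rw [key i i h, map_mul, aug_arrow, mul_zero, Pi.zero_apply, zero_smul]

section Height

/-- The elements that increase the height by at least `m`. -/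
def heightSubmodule (R : Set (TwoPath V →₀ k)) (h : V → ℤ) (m : ℕ) :
    Submodule k (QuiverAlg k R) where
  carrier := {a | ∀ i j, h j < h i + m → e k R i * a * e k R j = 0}
  add_mem' {a b} ha hb i j hij := by rw [mul_add, add_mul, ha i j hij, hb i j hij, add_zero]
  zero_mem' := by simp
  smul_mem' c a ha i j hij := by rw [mul_smul_comm, smul_mul_assoc, ha i j hij, smul_zero]

theorem mul_mem_heightSubmodule {h : V → ℤ} {m m' : ℕ} {a b : QuiverAlg k R}
    (ha : a ∈ heightSubmodule R h m) (hb : b ∈ heightSubmodule R h m') :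
    a * b ∈ heightSubmodule R h (m + m') := by
  intro i j hij
  rw [← mul_assoc, mul_assoc, mul_eq_sum]
  refine Finset.sum_eq_zero fun x _ => ?_
  by_cases hx : h x < h i + m
  · rw [ha i x hx, zero_mul]
  · rw [← mul_assoc (e k R x), hb x j (by push_cast at hij; omega), mul_zero]

theorem arrow_mem_heightSubmodule {h : V → ℤ} (hh : ∀ x y : V, (x ⟶ y) → h x < h y) {x y : V}
    (a : x ⟶ y) : arrow k R a ∈ heightSubmodule R h 1 := by
  intro i j hij
  by_cases hx : i = x
  · by_cases hy : y = j
    · subst hx hy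
      have := hh _ _ a
      push_cast at hij
      omega
    · rw [mul_assoc, arrow_mul_e_of_ne hy, mul_zero]
  · rw [e_mul_arrow_of_ne hx, zero_mul]

/-- The heights on a finite quiver are bounded. -/
theorem exists_heightSubmodule_eq_bot (R : Set (TwoPath V →₀ k)) (h : V → ℤ) :
    ∃ m, heightSubmodule R h m = ⊥ := by
  have hle : ∀ x, |h x| ≤ ∑ y, |h y| := fun x =>
    Finset.single_le_sum (f := fun y => |h y|) (fun _ _ => abs_nonneg _) (Finset.mem_univ x)
  refine ⟨(2 * (∑ x, |h x|) + 1).toNat, ?_⟩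
  rw [eq_bot_iff]
  intro a ha
  rw [Submodule.mem_bot, ← mul_one a, mul_eq_sum]
  refine Finset.sum_eq_zero fun j _ => ?_
  rw [mul_one, mul_assoc, e_mul_e, ← one_mul (a * _), mul_eq_sum]
  refine Finset.sum_eq_zero fun i _ => ?_
  rw [one_mul, ← mul_assoc, ← mul_assoc, e_mul_e]
  refine ha i j ?_
  have h1 := abs_le.1 (hle i)
  have h2 := abs_le.1 (hle j)
  omega

theorem isNilpotent_of_aug_eq_zero {h : V → ℤ} (hh : ∀ x y : V, (x ⟶ y) → h x < h y)
    {a : QuiverAlg k R} (ha : aug R a = 0) : IsNilpotent a := by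
  have hmem : a ∈ heightSubmodule R h 1 := by
    intro i j hij
    have hij' : ¬ h i < h j := by push_cast at hij; omega
    have := e_mul_mul_e (fun x y => h x < h y) (fun _ _ _ => lt_trans) hh a
    by_cases hne : i = j
    · subst hne
      rw [this.2 i hij', ha, Pi.zero_apply, zero_smul]
    · exact this.1 i j hij' hne
  have hpow : ∀ m : ℕ, a ^ (m + 1) ∈ heightSubmodule R h (m + 1) := by
    intro m
    induction m with
    | zero => simpa using hmem
    | succ m ih => rw [pow_succ]; exact mul_mem_heightSubmodule ih hmem
  obtain ⟨m, hm⟩ := exists_heightSubmodule_eq_bot R h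
  refine ⟨m + 1, ?_⟩
  have : heightSubmodule R h (m + 1) ≤ heightSubmodule R h m := fun b hb i j hij =>
    hb i j (by push_cast; omega)
  exact (Submodule.mem_bot k).1 (hm ▸ this (hpow m))

/-- A quiver algebra is basic if the arrows increase a height function. -/
theorem basicAugmentation {h : V → ℤ} (hh : ∀ x y : V, (x ⟶ y) → h x < h y) :
    BasicAugmentation (e k R) (aug R) where
  idem := e_mul_e
  sum_one := sum_e
  apply_same := aug_e_self
  apply_ne _ _ := aug_e_of_ne
  nil _ := isNilpotent_of_aug_eq_zero hh

/-- The span of the paths of length `m`. -/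
def pathSpan (R : Set (TwoPath V →₀ k)) : ℕ → Submodule k (QuiverAlg k R)
  | 0 => Submodule.span k (Set.range (e k R))
  | m + 1 => pathSpan R m *
      Submodule.span k (Set.range fun t : Quiver.Total V => arrow k R t.hom)

theorem pathSpan_mul_e (m : ℕ) {l : QuiverAlg k R} (hl : l ∈ pathSpan R m) (x : V) :
    l * e k R x ∈ pathSpan R m := by
  cases m with
  | zero =>
    induction hl using Submodule.span_induction with
    | mem l hl =>
      obtain ⟨y, rfl⟩ := hl
      by_cases hy : y = x
      · rw [hy, e_mul_e]; exact Submodule.subset_span ⟨x, rfl⟩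
      · rw [e_mul_e_of_ne hy]; exact zero_mem _
    | zero => rw [zero_mul]; exact zero_mem _
    | add a b _ _ ha hb => rw [add_mul]; exact add_mem ha hb
    | smul c a _ ha => rw [smul_mul_assoc]; exact Submodule.smul_mem _ c ha
  | succ m =>
    refine Submodule.mul_induction_on hl (fun a ha b hb => ?_) fun a b ha hb => ?_
    · rw [mul_assoc]
      refine Submodule.mul_mem_mul ha ?_
      induction hb using Submodule.span_induction with
      | mem l hl =>
        obtain ⟨t, rfl⟩ := hl
        by_cases hy : t.right = x
        · subst hy
          change arrow k R t.hom * _ ∈ _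
          rw [arrow_mul_e]; exact Submodule.subset_span ⟨t, rfl⟩
        · change arrow k R t.hom * _ ∈ _
          rw [arrow_mul_e_of_ne hy]; exact zero_mem _
      | zero => rw [zero_mul]; exact zero_mem _
      | add a b _ _ ha hb => rw [add_mul]; exact add_mem ha hb
      | smul c a _ ha => rw [smul_mul_assoc]; exact Submodule.smul_mem _ c ha
    · rw [add_mul]; exact add_mem ha hb

theorem pathSpan_le {h : V → ℤ} (hh : ∀ x y : V, (x ⟶ y) → h x < h y) (m : ℕ) :
    pathSpan R m ≤ heightSubmodule R h m := by
  induction m with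
  | zero =>
    refine Submodule.span_le.2 ?_
    rintro _ ⟨x, rfl⟩ i j hij
    by_cases hi : i = x
    · subst hi
      rw [e_mul_e, e_mul_e_of_ne]
      rintro rfl
      simp at hij
    · rw [e_mul_e_of_ne hi, zero_mul]
  | succ m ih =>
    refine Submodule.mul_le.2 fun a ha b hb => mul_mem_heightSubmodule (ih ha) ?_
    refine Submodule.span_le.2 ?_ hb
    rintro _ ⟨t, rfl⟩
    exact arrow_mem_heightSubmodule hh t.hom

theorem pathSpan_fg [∀ x y : V, Finite (x ⟶ y)] (m : ℕ) : (pathSpan R m).FG := by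
  induction m with
  | zero => exact Submodule.fg_span (Set.finite_range _)
  | succ m ih =>
    have : Finite (Quiver.Total V) :=
      Finite.of_injective
        (fun t => (⟨t.left, t.right, t.hom⟩ : Σ x y : V, (x ⟶ y))) (by
          rintro ⟨x, y, a⟩ ⟨x', y', a'⟩ h
          simp only [Sigma.mk.injEq] at h
          obtain ⟨rfl, h⟩ := h
          rw [heq_eq_eq, Sigma.mk.injEq] at h
          obtain ⟨rfl, h⟩ := h
          rw [eq_of_heq h])
    exact ih.mul (Submodule.fg_span (Set.finite_range _))

theorem finiteDimensional [∀ x y : V, Finite (x ⟶ y)] {h : V → ℤ}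
    (hh : ∀ x y : V, (x ⟶ y) → h x < h y) : FiniteDimensional k (QuiverAlg k R) := by
  obtain ⟨N, hN⟩ := exists_heightSubmodule_eq_bot R h
  have hbot : pathSpan R N = ⊥ := eq_bot_iff.2 ((pathSpan_le hh N).trans hN.le)
  refine ⟨?_⟩
  suffices H : (⨆ m : Fin (N + 1), pathSpan R (m : ℕ)) = ⊤ by
    rw [← H]
    exact Submodule.fg_iSup _ fun m => pathSpan_fg (m : ℕ)
  have hle : ∀ m : Fin (N + 1), pathSpan R (m : ℕ) ≤ ⨆ m : Fin (N + 1), pathSpan R (m : ℕ) :=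
    le_iSup (fun m : Fin (N + 1) => pathSpan R (m : ℕ))
  refine eq_top_iff.2 fun l _ => mem_of_mul_mem _ ?_ (fun l hl x => ?_) (fun l hl x y a => ?_) l
  · rw [← sum_e (R := R)]
    exact sum_mem fun x _ => hle 0 (Submodule.subset_span ⟨x, rfl⟩)
  · induction hl using Submodule.iSup_induction' with
    | mem m l hl => exact hle m (pathSpan_mul_e m hl x)
    | zero => rw [zero_mul]; exact zero_mem _
    | add a b _ _ ha hb => rw [add_mul]; exact add_mem ha hb
  · induction hl using Submodule.iSup_induction' with
    | mem m l hl =>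
      have hmem : l * arrow k R a ∈ pathSpan R ((m : ℕ) + 1) :=
        Submodule.mul_mem_mul hl (Submodule.subset_span ⟨⟨x, y, a⟩, rfl⟩)
      by_cases hm : (m : ℕ) = N
      · rw [hm] at hl
        rw [hbot, Submodule.mem_bot] at hl
        rw [hl, zero_mul]
        exact zero_mem _
      · exact hle ⟨m + 1, by omega⟩ hmem
    | zero => rw [zero_mul]; exact zero_mem _
    | add a b _ _ ha hb => rw [add_mul]; exact add_mem ha hb

end Height

end QuiverAlg

/-! ### Vertices and arrows of the quivers -/

namespace Zigzag

variable {n s : ℕ}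

theorem stepVec_apply (i j : Fin (n + 1)) :
    stepVec i j = (if j = i then 1 else 0) - (if j = i - 1 then 1 else 0) := by
  simp [stepVec, Pi.single_apply]

theorem sum_stepVec (i : Fin (n + 1)) : ∑ j, stepVec i j = 0 := by
  simp [stepVec]

theorem val_sub_one_of_ne {i : Fin (n + 1)} (h : i ≠ 0) : ((i - 1 : Fin (n + 1)) : ℕ) + 1 = i := by
  have := Fin.coe_sub_one i
  rw [if_neg h] at this
  have : (i : ℕ) ≠ 0 := fun h' => h (Fin.ext h')
  omega

theorem val_zero_sub_one : ((0 - 1 : Fin (n + 1)) : ℕ) = n := by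
  rw [Fin.coe_sub_one, if_pos rfl]

theorem sub_one_ne (hn : 1 ≤ n) (i : Fin (n + 1)) : i - 1 ≠ i := by
  intro h
  by_cases hi : i = 0
  · subst hi
    have := val_zero_sub_one (n := n)
    rw [h] at this
    simp at this
    omega
  · have := val_sub_one_of_ne hi
    rw [h] at this
    omega

theorem stepVec_self (hn : 1 ≤ n) (i : Fin (n + 1)) : stepVec i i = 1 := by
  rw [stepVec_apply, if_pos rfl, if_neg (sub_one_ne hn i).symm, sub_zero]

theorem stepVec_sub_one (hn : 1 ≤ n) (i : Fin (n + 1)) : stepVec i (i - 1) = -1 := by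
  rw [stepVec_apply, if_pos rfl, if_neg (sub_one_ne hn i), zero_sub]

theorem stepVec_nonneg {i j : Fin (n + 1)} (h : j ≠ i - 1) : 0 ≤ stepVec i j := by
  rw [stepVec_apply, if_neg h]
  split_ifs <;> simp

theorem neg_one_le_stepVec (i j : Fin (n + 1)) : -1 ≤ stepVec i j := by
  rw [stepVec_apply]
  split_ifs <;> simp

theorem stepVec_nonpos {i j : Fin (n + 1)} (h : j ≠ i) : stepVec i j ≤ 0 := by
  rw [stepVec_apply, if_neg h]
  split_ifs <;> simp

theorem vtx_ext {x y : Vtx n s} (h : ∀ j, (x.1 j : ℤ) = y.1 j) : x = y :=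
  Subtype.ext (funext fun j => Int.natCast_inj.1 (h j))

/-- The vertex `x + v`, for a vector `v` with sum zero. -/
def addVec (x : Vtx n s) (v : Fin (n + 1) → ℤ) (h0 : ∀ j, 0 ≤ (x.1 j : ℤ) + v j)
    (hv : ∑ j, v j = 0) : Vtx n s :=
  ⟨fun j => ((x.1 j : ℤ) + v j).toNat, by
    have hx := x.2
    zify at hx ⊢
    rw [← hx]
    congr 1
    simp_rw [Int.toNat_of_nonneg (h0 _), Finset.sum_add_distrib, hv, add_zero]⟩

theorem addVec_apply (x : Vtx n s) (v : Fin (n + 1) → ℤ) (h0 : ∀ j, 0 ≤ (x.1 j : ℤ) + v j)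
    (hv : ∑ j, v j = 0) (j : Fin (n + 1)) : ((addVec x v h0 hv).1 j : ℤ) = x.1 j + v j :=
  Int.toNat_of_nonneg (h0 j)

theorem exists_add_stepVec {x : Vtx n s} {i : Fin (n + 1)} (h : 0 < x.1 (i - 1)) :
    ∃ y : Vtx n s, ∀ j, (y.1 j : ℤ) = x.1 j + stepVec i j := by
  refine ⟨addVec x (stepVec i) (fun j => ?_) (sum_stepVec i), addVec_apply x _ _ _⟩
  by_cases hj : j = i - 1
  · have := neg_one_le_stepVec i j
    rw [← hj] at h
    omega
  · have := stepVec_nonneg hj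
    omega

theorem exists_sub_stepVec {x : Vtx n s} {i : Fin (n + 1)} (h : 0 < x.1 i) :
    ∃ y : Vtx n s, ∀ j, (x.1 j : ℤ) = y.1 j + stepVec i j := by
  have h1 : ∀ j, 0 ≤ (x.1 j : ℤ) + -stepVec i j := by
    intro j
    rw [stepVec_apply]
    by_cases hj : j = i
    · subst hj
      split_ifs <;> omega
    · rw [if_neg hj]
      split_ifs <;> omega
  refine ⟨addVec x (fun j => -stepVec i j) h1 ?_, fun j => ?_⟩
  · rw [Finset.sum_neg_distrib, sum_stepVec, neg_zero]
  · rw [addVec_apply]; ring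

/-- There is a permutation of the vertices that takes `x` to `x - f_0` whenever this is a vertex.
Its values at the other vertices are irrelevant. -/
theorem exists_shift (hn : 1 ≤ n) (s : ℕ) : ∃ θ : Equiv.Perm (Vtx n s), ∀ x, 0 < x.1 0 →
    ∀ j, (x.1 j : ℤ) = (θ x).1 j + stepVec 0 j := by
  classical
  have h1 : ∀ x : {x : Vtx n s // 0 < x.1 0}, ∃ y : {y : Vtx n s // 0 < y.1 (0 - 1)},
      ∀ j, (x.1.1 j : ℤ) = y.1.1 j + stepVec 0 j := by
    rintro ⟨x, hx⟩
    obtain ⟨y, hy⟩ := exists_sub_stepVec hx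
    have := hy (0 - 1)
    rw [stepVec_sub_one hn] at this
    exact ⟨⟨y, by omega⟩, hy⟩
  have h2 : ∀ y : {y : Vtx n s // 0 < y.1 (0 - 1)}, ∃ x : {x : Vtx n s // 0 < x.1 0},
      ∀ j, (x.1.1 j : ℤ) = y.1.1 j + stepVec 0 j := by
    rintro ⟨y, hy⟩
    obtain ⟨x, hx⟩ := exists_add_stepVec hy
    have := hx 0
    rw [stepVec_self hn] at this
    exact ⟨⟨x, by omega⟩, hx⟩
  choose g hg using h1
  choose g' hg' using h2
  let E : {x : Vtx n s // 0 < x.1 0} ≃ {y : Vtx n s // 0 < y.1 (0 - 1)} :=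
    ⟨g, g', fun x => Subtype.ext (vtx_ext fun j => by rw [hg', ← hg]),
      fun y => Subtype.ext (vtx_ext fun j => by have := hg (g' y) j; have := hg' y j; omega)⟩
  refine ⟨E.extendSubtype, fun x hx j => ?_⟩
  rw [E.extendSubtype_apply_of_mem x hx]
  exact hg ⟨x, hx⟩ j

/-- A permutation of the vertices with `shift x + f_0 = x` if `x_0 > 0`. -/
noncomputable def shift (hn : 1 ≤ n) (s : ℕ) : Equiv.Perm (Vtx n s) := (exists_shift hn s).choose

theorem shift_spec (hn : 1 ≤ n) {x : Vtx n s} (hx : 0 < x.1 0) (j : Fin (n + 1)) :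
    (x.1 j : ℤ) = (shift hn s x).1 j + stepVec 0 j := (exists_shift hn s).choose_spec x hx j

theorem label_spec {x y : Vtx n s} (a : x ⟶ y) (j : Fin (n + 1)) :
    (y.1 j : ℤ) = x.1 j + stepVec (label a) j := a.2 j

theorem pos_of_label_eq_zero (hn : 1 ≤ n) {x y : Vtx n s} (a : x ⟶ y) (ha : label a = 0) :
    0 < y.1 0 := by
  have := label_spec a 0
  rw [ha, stepVec_self hn] at this
  omega

theorem shift_eq (hn : 1 ≤ n) {x y : Vtx n s} (a : x ⟶ y) (ha : label a = 0) :
    shift hn s y = x := by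
  refine vtx_ext fun j => ?_
  have h1 := shift_spec hn (pos_of_label_eq_zero hn a ha) j
  have h2 := label_spec a j
  rw [ha] at h2
  omega

theorem pos_of_pos {x y : Vtx n s} (a : x ⟶ y) (ha : label a ≠ 0) (hy : 0 < y.1 0) :
    0 < x.1 0 := by
  have h1 := label_spec a 0
  have h2 := stepVec_nonpos (i := label a) ha.symm
  omega

theorem label_eq_one (a : Fin (n + 1)) (h : stepVec a 0 < 0) : a = 1 := by
  by_contra hne
  refine absurd (stepVec_nonneg (i := a) (j := 0) fun h0 => hne ?_) (not_le.2 h)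
  exact (sub_eq_zero.1 h0.symm)

theorem shift_zero_eq (hn : 1 ≤ n) {x y : Vtx n s} (a : x ⟶ y) (hx : 0 < x.1 0)
    (hy : y.1 0 = 0) : label a = 1 ∧ (shift hn s x).1 0 = 0 := by
  have h1 := label_spec a 0
  have h2 := neg_one_le_stepVec (label a) 0
  have h3 := shift_spec hn hx 0
  rw [stepVec_self hn] at h3
  exact ⟨label_eq_one _ (by omega), by omega⟩

instance (x y : Vtx n s) : Finite (x ⟶ y) :=
  inferInstanceAs (Finite {i : Fin (n + 1) // ∀ j, (y.1 j : ℤ) = x.1 j + stepVec i j})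

instance (x y : DirVtx n s) : Finite (x ⟶ y) :=
  inferInstanceAs (Finite {a : inclVtx x ⟶ inclVtx y // a.1 ≠ 0})

theorem lt_of_arrow {x y : DirVtx n s} (a : x ⟶ y) : inclVtx x < inclVtx y :=
  lt_of_le_of_ne ⟨a.toPath⟩ fun h => (height_arrow a).ne (congrArg height h)

/-- The composite of arrows `α_1, …, α_n` leads from `x` to `x - f_0`. -/
theorem lt_shift (hn : 1 ≤ n) {x : Vtx n s} (hx : 0 < x.1 0) : x < shift hn s x := by
  have key : ∀ m (hm : m < n + 1), ∃ y : Vtx n s, x ≤ y ∧ ∀ j, (y.1 j : ℤ) =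
      x.1 j + (if j = ⟨m, hm⟩ then 1 else 0) - (if j = 0 then 1 else 0) := by
    intro m
    induction m with
    | zero =>
      intro hm
      exact ⟨x, le_rfl, fun j => (add_sub_cancel_right _ _).symm⟩
    | succ m ih =>
      intro hm
      obtain ⟨y, hxy, hy⟩ := ih (by omega)
      set i : Fin (n + 1) := ⟨m + 1, hm⟩
      have hi0 : i ≠ 0 := fun h => by simpa [i] using congrArg Fin.val h
      have hi : i - 1 = ⟨m, by omega⟩ := Fin.ext (by
        have := val_sub_one_of_ne hi0
        simp only [i] at this ⊢
        omega)
      have hpos : 0 < y.1 (i - 1) := by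
        have := hy (i - 1)
        rw [if_pos hi] at this
        split_ifs at this with h0
        · rw [h0] at this ⊢
          omega
        · omega
      obtain ⟨z, hz⟩ := exists_add_stepVec hpos
      have a : @Quiver.Hom (DirVtx n s) _ y z := ⟨⟨i, hz⟩, hi0⟩
      refine ⟨z, hxy.trans (lt_of_arrow a).le, fun j => ?_⟩
      rw [hz, hy, stepVec_apply, hi]
      ring
  obtain ⟨y, hxy, hy⟩ := key n (Nat.lt_succ_self n)
  have hlast : (0 - 1 : Fin (n + 1)) = ⟨n, Nat.lt_succ_self n⟩ := Fin.ext val_zero_sub_one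
  have : y = shift hn s x := vtx_ext fun j => by
    have h1 := hy j
    have h2 := shift_spec hn hx j
    rw [stepVec_apply, hlast] at h2
    omega
  refine lt_of_le_of_ne (this ▸ hxy) fun h => ?_
  have h3 := shift_spec hn hx 0
  rw [stepVec_self hn, ← h] at h3
  omega

end Zigzag

/-! ### The quasi-hereditary cover as an extension of the bound path algebra of `Q'` -/

namespace Zigzag

variable {k : Type u} [Field k] {n s : ℕ}

/-- The path algebra of `Q'` bound by the relations of the Borel subalgebra. -/
abbrev BorelAlg (k : Type u) [Field k] (n s : ℕ) : Type u := QuiverAlg k {r | BorelRel k n s r}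

/-- The idempotent `e_x` of `BorelAlg`. -/
noncomputable def bE (k : Type u) [Field k] {n s : ℕ} (x : Vtx n s) : BorelAlg k n s :=
  QuiverAlg.e k _ (show DirVtx n s from x)

/-- The class of an arrow in `BorelAlg`. -/
noncomputable def bA (k : Type u) [Field k] {n s : ℕ} {x y : DirVtx n s} (a : x ⟶ y) :
    BorelAlg k n s :=
  QuiverAlg.arrow k _ a

theorem bE_mul_self (x : Vtx n s) : bE k x * bE k x = bE k x := QuiverAlg.e_mul_e _

theorem bE_mul_of_ne {x y : Vtx n s} (h : x ≠ y) : bE k x * bE k y = 0 :=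
  QuiverAlg.e_mul_e_of_ne h

theorem sum_bE : ∑ x : Vtx n s, bE k x = 1 :=
  QuiverAlg.sum_e (V := DirVtx n s)

theorem bE_mul_bA {x y : DirVtx n s} (a : x ⟶ y) : bE k (inclVtx x) * bA k a = bA k a :=
  QuiverAlg.e_mul_arrow a

theorem bA_mul_bE {x y : DirVtx n s} (a : x ⟶ y) : bA k a * bE k (inclVtx y) = bA k a :=
  QuiverAlg.arrow_mul_e a

theorem bA_comm {x y y' z : DirVtx n s} (a : x ⟶ y) (b : y ⟶ z) (c : x ⟶ y') (d : y' ⟶ z)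
    (h : dirLabel a = dirLabel d) (h' : dirLabel b = dirLabel c) :
    bA k a * bA k b = bA k c * bA k d :=
  QuiverAlg.arrow_mul_arrow_eq (.comm a b c d h h')

theorem bA_square {x y z : DirVtx n s} (a : x ⟶ y) (b : y ⟶ z) (h : dirLabel a = dirLabel b) :
    bA k a * bA k b = 0 :=
  QuiverAlg.arrow_mul_arrow_eq_zero (.square a b h)

theorem bA_congr {x y x' y' : DirVtx n s} (a : x ⟶ y) (a' : x' ⟶ y') (hx : x = x') (hy : y = y')
    (h : dirLabel a = dirLabel a') : bA k a = bA k a' := by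
  subst hx hy
  rw [show a = a' from Subtype.ext (Subtype.ext h)]

/-- The arrow `α_i` from `x` to `y`, shifted by `-f_0`; zero if a vertex leaves the quiver. -/
noncomputable def shiftArrow (k : Type u) [Field k] (hn : 1 ≤ n) {x y : DirVtx n s} (a : x ⟶ y) :
    BorelAlg k n s :=
  if h : 0 < (inclVtx y).1 0 then
    bA k (x := shift hn s (inclVtx x)) (y := shift hn s (inclVtx y)) ⟨⟨dirLabel a, fun j => by
      have h1 := shift_spec hn h j
      have h2 := shift_spec hn (pos_of_pos (inclArrow a) a.2 h) j
      have h3 := label_spec (inclArrow a) j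
      change _ = _ + stepVec (label (inclArrow a)) j
      omega⟩, a.2⟩
  else 0

theorem shiftArrow_of_pos (hn : 1 ≤ n) {x y x' y' : DirVtx n s} (a : x ⟶ y) (a' : x' ⟶ y')
    (hy : 0 < (inclVtx y).1 0) (hx' : shift hn s (inclVtx x) = inclVtx x')
    (hy' : shift hn s (inclVtx y) = inclVtx y') (h : dirLabel a = dirLabel a') :
    shiftArrow k hn a = bA k a' := by
  rw [shiftArrow, dif_pos hy]
  exact bA_congr _ _ hx' hy' h

theorem shiftArrow_eq (hn : 1 ≤ n) {x y : DirVtx n s} (a : x ⟶ y) (hy : 0 < (inclVtx y).1 0) :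
    ∃ a' : @Quiver.Hom (DirVtx n s) _ (shift hn s (inclVtx x)) (shift hn s (inclVtx y)),
      dirLabel a' = dirLabel a ∧ shiftArrow k hn a = bA k a' := by
  rw [shiftArrow, dif_pos hy]
  exact ⟨_, rfl, rfl⟩

theorem shiftArrow_of_eq_zero (hn : 1 ≤ n) {x y : DirVtx n s} (a : x ⟶ y)
    (hy : (inclVtx y).1 0 = 0) : shiftArrow k hn a = 0 := by
  rw [shiftArrow, dif_neg (by omega)]

theorem bE_mul_shiftArrow (hn : 1 ≤ n) {x y : DirVtx n s} (a : x ⟶ y) :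
    bE k (shift hn s (inclVtx x)) * shiftArrow k hn a = shiftArrow k hn a := by
  rw [shiftArrow]
  split_ifs
  · exact bE_mul_bA _
  · exact mul_zero _

theorem shiftArrow_mul_bE (hn : 1 ≤ n) {x y : DirVtx n s} (a : x ⟶ y) :
    shiftArrow k hn a * bE k (shift hn s (inclVtx y)) = shiftArrow k hn a := by
  rw [shiftArrow]
  split_ifs
  · exact bA_mul_bE _
  · exact zero_mul _

theorem shiftArrow_comm (hn : 1 ≤ n) {x y y' z : DirVtx n s} (a : x ⟶ y) (b : y ⟶ z) (c : x ⟶ y')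
    (d : y' ⟶ z) (h : dirLabel a = dirLabel d) (h' : dirLabel b = dirLabel c) :
    shiftArrow k hn a * shiftArrow k hn b = shiftArrow k hn c * shiftArrow k hn d := by
  by_cases hz : 0 < (inclVtx z).1 0
  · obtain ⟨a', ha, ha'⟩ := shiftArrow_eq (k := k) hn a (pos_of_pos (inclArrow b) b.2 hz)
    obtain ⟨b', hb, hb'⟩ := shiftArrow_eq (k := k) hn b hz
    obtain ⟨c', hc, hc'⟩ := shiftArrow_eq (k := k) hn c (pos_of_pos (inclArrow d) d.2 hz)
    obtain ⟨d', hd, hd'⟩ := shiftArrow_eq (k := k) hn d hz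
    rw [ha', hb', hc', hd']
    exact bA_comm _ _ _ _ (by rw [ha, hd, h]) (by rw [hb, hc, h'])
  · rw [shiftArrow_of_eq_zero hn b (by omega), shiftArrow_of_eq_zero hn d (by omega), mul_zero,
      mul_zero]

theorem shiftArrow_square (hn : 1 ≤ n) {x y z : DirVtx n s} (a : x ⟶ y) (b : y ⟶ z)
    (h : dirLabel a = dirLabel b) : shiftArrow k hn a * shiftArrow k hn b = 0 := by
  by_cases hz : 0 < (inclVtx z).1 0
  · obtain ⟨a', ha, ha'⟩ := shiftArrow_eq (k := k) hn a (pos_of_pos (inclArrow b) b.2 hz)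
    obtain ⟨b', hb, hb'⟩ := shiftArrow_eq (k := k) hn b hz
    rw [ha', hb']
    exact bA_square _ _ (by rw [ha, hb, h])
  · rw [shiftArrow_of_eq_zero hn b (by omega), mul_zero]

theorem coverArrow_comm {x y y' z : Vtx n (s + 1)} (a : x ⟶ y) (b : y ⟶ z) (c : x ⟶ y')
    (d : y' ⟶ z) (h : label a = label d) (h' : label b = label c) :
    coverArrow k n s a * coverArrow k n s b = coverArrow k n s c * coverArrow k n s d :=
  QuiverAlg.arrow_mul_arrow_eq (.zigzag _ (.comm a b c d h h'))

theorem coverArrow_square {x y z : Vtx n (s + 1)} (a : x ⟶ y) (b : y ⟶ z)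
    (h : label a = label b) : coverArrow k n s a * coverArrow k n s b = 0 :=
  QuiverAlg.arrow_mul_arrow_eq_zero (.zigzag _ (.square a b h))

theorem coverArrow_cut {x y z : Vtx n (s + 1)} (hx : x.1 0 = 0) (a : x ⟶ y) (b : y ⟶ z)
    (ha : label a = 0) (hb : label b = 1) : coverArrow k n s a * coverArrow k n s b = 0 :=
  QuiverAlg.arrow_mul_arrow_eq_zero (.cut hx a b ha hb)

theorem coverArrow_congr {x y x' y' : Vtx n (s + 1)} (a : x ⟶ y) (a' : x' ⟶ y') (hx : x = x')
    (hy : y = y') (h : label a = label a') : coverArrow k n s a = coverArrow k n s a' := by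
  subst hx hy
  rw [show a = a' from Subtype.ext h]

theorem coverIdem_mul_of_ne {x y : Vtx n (s + 1)} (h : x ≠ y) :
    coverIdem k n s x * coverIdem k n s y = 0 := QuiverAlg.e_mul_e_of_ne h

theorem sum_smul_single {V : Type} [Quiver.{0} V] {M : Type u} [AddCommGroup M] [Module k M]
    (F : TwoPath V → M) (p : TwoPath V) :
    ((Finsupp.single p (1 : k)).sum fun p c => c • F p) = F p := by
  rw [Finsupp.sum_single_index (by rw [zero_smul]), one_smul]

theorem sum_smul_single_sub {V : Type} [Quiver.{0} V] {M : Type u} [AddCommGroup M] [Module k M]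
    (F : TwoPath V → M) (p p' : TwoPath V) :
    ((Finsupp.single p (1 : k) - Finsupp.single p' 1).sum fun p c => c • F p) = F p - F p' := by
  rw [Finsupp.sum_sub_index (fun _ _ _ => sub_smul _ _ _), sum_smul_single, sum_smul_single]

/-- The canonical homomorphism from the bound path algebra of `Q'` to the cover. -/
noncomputable def incl (k : Type u) [Field k] (n s : ℕ) : BorelAlg k n (s + 1) →ₐ[k] Cover k n s :=
  QuiverAlg.lift (fun x => coverIdem k n s (inclVtx x))
    (fun _ _ a => coverArrow k n s (inclArrow a)) (fun _ => QuiverAlg.e_mul_e _)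
    (fun _ _ h => QuiverAlg.e_mul_e_of_ne h)
    (show ∑ x : Vtx n (s + 1), coverIdem k n s x = 1 from QuiverAlg.sum_e)
    (fun _ _ _ => QuiverAlg.e_mul_arrow _)
    (fun _ _ _ => QuiverAlg.arrow_mul_e _) (by
      rintro _ (⟨a, b, c, d, h, h'⟩ | ⟨a, b, h⟩)
      · rw [sum_smul_single_sub (F := fun p => coverArrow k n s (inclArrow p.a) *
          coverArrow k n s (inclArrow p.b)), sub_eq_zero]
        exact coverArrow_comm _ _ _ _ h h'
      · rw [sum_smul_single (F := fun p => coverArrow k n s (inclArrow p.a) *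
          coverArrow k n s (inclArrow p.b))]
        exact coverArrow_square _ _ h)

theorem incl_bE (x : Vtx n (s + 1)) : incl k n s (bE k x) = coverIdem k n s x :=
  QuiverAlg.lift_e _

theorem incl_bA {x y : DirVtx n (s + 1)} (a : x ⟶ y) :
    incl k n s (bA k a) = coverArrow k n s (inclArrow a) :=
  QuiverAlg.lift_arrow a

/-- The image of an arrow under the representation of the cover by matrices over `BorelAlg`. -/
noncomputable def matArrow (k : Type u) [Field k] (hn : 1 ≤ n) {x y : Vtx n (s + 1)} (a : x ⟶ y) :
    Matrix (Fin 2) (Fin 2) (BorelAlg k n (s + 1)) :=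
  if h : label a = 0 then !![0, bE k x; 0, 0]
  else !![bA k (x := x) (y := y) ⟨a, h⟩, 0; 0, shiftArrow k hn (x := x) (y := y) ⟨a, h⟩]

theorem matArrow_of_eq (hn : 1 ≤ n) {x y : Vtx n (s + 1)} (a : x ⟶ y) (h : label a = 0) :
    matArrow k hn a = !![0, bE k x; 0, 0] := dif_pos h

theorem matArrow_of_ne (hn : 1 ≤ n) {x y : Vtx n (s + 1)} (a : x ⟶ y) (h : label a ≠ 0) :
    matArrow k hn a =
      !![bA k (x := x) (y := y) ⟨a, h⟩, 0; 0, shiftArrow k hn (x := x) (y := y) ⟨a, h⟩] :=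
  dif_neg h

/-- Passing `α_0` from the left of an arrow of `Q'` to its right shifts the arrow. -/
theorem shiftArrow_eq_of_square (hn : 1 ≤ n) {x y y' z : Vtx n (s + 1)} (a : x ⟶ y) (b : y ⟶ z)
    (c : x ⟶ y') (d : y' ⟶ z) (ha : label a = 0) (hd : label d = 0) (hb : label b ≠ 0)
    (hc : label c ≠ 0) (h : label b = label c) :
    shiftArrow k hn (x := y) (y := z) ⟨b, hb⟩ = bA k (x := x) (y := y') ⟨c, hc⟩ :=
  shiftArrow_of_pos hn (x := y) (y := z) (x' := x) (y' := y') _ _ (pos_of_label_eq_zero hn d hd)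
    (shift_eq hn a ha) (shift_eq hn d hd) h

theorem matArrow_comm (hn : 1 ≤ n) {x y y' z : Vtx n (s + 1)} (a : x ⟶ y) (b : y ⟶ z)
    (c : x ⟶ y') (d : y' ⟶ z) (h : label a = label d) (h' : label b = label c) :
    matArrow k hn a * matArrow k hn b = matArrow k hn c * matArrow k hn d := by
  by_cases ha : label a = 0 <;> by_cases hb : label b = 0
  · rw [matArrow_of_eq hn a ha, matArrow_of_eq hn b hb, matArrow_of_eq hn c (h' ▸ hb),
      matArrow_of_eq hn d (h ▸ ha)]
    simp
  · have hc : label c ≠ 0 := h' ▸ hb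
    have hd : label d = 0 := h ▸ ha
    rw [matArrow_of_eq hn a ha, matArrow_of_ne hn b hb, matArrow_of_ne hn c hc,
      matArrow_of_eq hn d hd, shiftArrow_eq_of_square hn a b c d ha hd hb hc h']
    have h1 := bE_mul_bA (k := k) (x := x) (y := y') ⟨c, hc⟩
    have h2 := bA_mul_bE (k := k) (x := x) (y := y') ⟨c, hc⟩
    simp only [inclVtx] at h1 h2
    ext i j
    fin_cases i <;> fin_cases j <;> simp [h1, h2]
  · have hc : label c = 0 := h' ▸ hb
    have hd : label d ≠ 0 := h ▸ ha
    rw [matArrow_of_ne hn a ha, matArrow_of_eq hn b hb, matArrow_of_eq hn c hc,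
      matArrow_of_ne hn d hd, shiftArrow_eq_of_square hn c d a b hc hb hd ha h.symm]
    have h1 := bE_mul_bA (k := k) (x := x) (y := y) ⟨a, ha⟩
    have h2 := bA_mul_bE (k := k) (x := x) (y := y) ⟨a, ha⟩
    simp only [inclVtx] at h1 h2
    ext i j
    fin_cases i <;> fin_cases j <;> simp [h1, h2]
  · have hc : label c ≠ 0 := h' ▸ hb
    have hd : label d ≠ 0 := h ▸ ha
    rw [matArrow_of_ne hn a ha, matArrow_of_ne hn b hb, matArrow_of_ne hn c hc,
      matArrow_of_ne hn d hd]
    simp only [Matrix.mul_fin_two, mul_zero, zero_mul, add_zero, zero_add]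
    rw [bA_comm (x := x) (y := y) (z := z) (y' := y') ⟨a, ha⟩ ⟨b, hb⟩ ⟨c, hc⟩ ⟨d, hd⟩ h h',
      shiftArrow_comm hn (x := x) (y := y) (z := z) (y' := y') ⟨a, ha⟩ ⟨b, hb⟩ ⟨c, hc⟩ ⟨d, hd⟩
        h h']

theorem matArrow_square (hn : 1 ≤ n) {x y z : Vtx n (s + 1)} (a : x ⟶ y) (b : y ⟶ z)
    (h : label a = label b) : matArrow k hn a * matArrow k hn b = 0 := by
  by_cases ha : label a = 0
  · rw [matArrow_of_eq hn a ha, matArrow_of_eq hn b (h ▸ ha)]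
    ext i j
    fin_cases i <;> fin_cases j <;> simp
  · have hb : label b ≠ 0 := h ▸ ha
    rw [matArrow_of_ne hn a ha, matArrow_of_ne hn b hb]
    have h1 := bA_square (k := k) (x := x) (y := y) (z := z) ⟨a, ha⟩ ⟨b, hb⟩ h
    have h2 := shiftArrow_square (k := k) hn (x := x) (y := y) (z := z) ⟨a, ha⟩ ⟨b, hb⟩ h
    ext i j
    fin_cases i <;> fin_cases j <;> simp [h1, h2]

theorem matArrow_cut (hn : 1 ≤ n) {x y z : Vtx n (s + 1)} (hx : x.1 0 = 0) (a : x ⟶ y) (b : y ⟶ z)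
    (ha : label a = 0) (hb : label b = 1) : matArrow k hn a * matArrow k hn b = 0 := by
  have hb0 : label b ≠ 0 := by
    rw [hb]
    intro h
    have := sub_one_ne hn (1 : Fin (n + 1))
    rw [sub_self, h] at this
    exact this rfl
  have hz : z.1 0 = 0 := by
    have h1 := label_spec a 0
    have h2 := label_spec b 0
    have h3 := stepVec_sub_one hn (1 : Fin (n + 1))
    rw [sub_self] at h3
    rw [ha, stepVec_self hn] at h1
    rw [hb, h3] at h2
    omega
  rw [matArrow_of_eq hn a ha, matArrow_of_ne hn b hb0,
    shiftArrow_of_eq_zero hn (x := y) (y := z) _ hz]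
  ext i j
  fin_cases i <;> fin_cases j <;> simp

/-- The representation of the cover by upper triangular matrices over `BorelAlg`: the arrows of `Q'`
act diagonally, by themselves and by their shifts, and `α_0` as the matrix unit in the corner. -/
noncomputable def toMat (k : Type u) [Field k] (hn : 1 ≤ n) (s : ℕ) :
    Cover k n s →ₐ[k] Matrix (Fin 2) (Fin 2) (BorelAlg k n (s + 1)) :=
  QuiverAlg.lift (fun x => !![bE k x, 0; 0, bE k (shift hn (s + 1) x)])
    (fun _ _ a => matArrow k hn a)
    (fun x => by simp [bE_mul_self])
    (fun x y h => by
      have h' : shift hn (s + 1) x ≠ shift hn (s + 1) y := fun H => h (Equiv.injective _ H)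
      ext i j
      fin_cases i <;> fin_cases j <;> simp [bE_mul_of_ne h, bE_mul_of_ne h'])
    (by
      have h := (Equiv.sum_comp (shift hn (s + 1)) (bE k)).trans sum_bE
      ext i j
      fin_cases i <;> fin_cases j <;> simp [Matrix.sum_apply, sum_bE, h])
    (fun x y a => by
      by_cases ha : label a = 0
      · rw [matArrow_of_eq hn a ha]
        simp [bE_mul_self]
      · rw [matArrow_of_ne hn a ha]
        have h1 := bE_mul_bA (k := k) (x := x) (y := y) ⟨a, ha⟩
        have h2 := bE_mul_shiftArrow (k := k) hn (x := x) (y := y) ⟨a, ha⟩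
        simp only [inclVtx] at h1 h2
        simp [h1, h2])
    (fun x y a => by
      by_cases ha : label a = 0
      · rw [matArrow_of_eq hn a ha]
        ext i j
        fin_cases i <;> fin_cases j <;> simp [shift_eq hn a ha, bE_mul_self]
      · rw [matArrow_of_ne hn a ha]
        have h1 := bA_mul_bE (k := k) (x := x) (y := y) ⟨a, ha⟩
        have h2 := shiftArrow_mul_bE (k := k) hn (x := x) (y := y) ⟨a, ha⟩
        simp only [inclVtx] at h1 h2
        simp [h1, h2])
    (by
      rintro _ (⟨_, ⟨a, b, c, d, h, h'⟩ | ⟨a, b, h⟩⟩ | ⟨hx, a, b, ha, hb⟩)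
      · rw [sum_smul_single_sub (F := fun p => matArrow k hn p.a * matArrow k hn p.b),
          sub_eq_zero]
        exact matArrow_comm hn _ _ _ _ h h'
      · rw [sum_smul_single (F := fun p => matArrow k hn p.a * matArrow k hn p.b)]
        exact matArrow_square hn _ _ h
      · rw [sum_smul_single (F := fun p => matArrow k hn p.a * matArrow k hn p.b)]
        exact matArrow_cut hn hx _ _ ha hb)

theorem toMat_coverIdem (hn : 1 ≤ n) (x : Vtx n (s + 1)) :
    toMat k hn s (coverIdem k n s x) = !![bE k x, 0; 0, bE k (shift hn (s + 1) x)] :=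
  QuiverAlg.lift_e x

theorem toMat_coverArrow (hn : 1 ≤ n) {x y : Vtx n (s + 1)} (a : x ⟶ y) :
    toMat k hn s (coverArrow k n s a) = matArrow k hn a :=
  QuiverAlg.lift_arrow a

theorem toMat_lower (hn : 1 ≤ n) (l : Cover k n s) : toMat k hn s l 1 0 = 0 := by
  let S : Submodule k (Cover k n s) :=
    { carrier := {l | toMat k hn s l 1 0 = 0}
      add_mem' := fun {a b} ha hb => by
        change toMat k hn s (a + b) 1 0 = 0
        rw [map_add, Matrix.add_apply, show toMat k hn s a 1 0 = 0 from ha,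
          show toMat k hn s b 1 0 = 0 from hb, add_zero]
      zero_mem' := by
        change toMat k hn s 0 1 0 = 0
        rw [map_zero, Matrix.zero_apply]
      smul_mem' := fun c a ha => by
        change toMat k hn s (c • a) 1 0 = 0
        rw [map_smul, Matrix.smul_apply, show toMat k hn s a 1 0 = 0 from ha, smul_zero] }
  refine QuiverAlg.mem_of_mul_mem S ?_ (fun l hl x => ?_) (fun l hl x y a => ?_) l
  · change toMat k hn s 1 1 0 = 0
    rw [map_one]
    rfl
  · change toMat k hn s (l * coverIdem k n s x) 1 0 = 0
    rw [map_mul, toMat_coverIdem, Matrix.mul_apply, Fin.sum_univ_two,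
      show toMat k hn s l 1 0 = 0 from hl]
    simp
  · change toMat k hn s (l * coverArrow k n s a) 1 0 = 0
    rw [map_mul, toMat_coverArrow, Matrix.mul_apply, Fin.sum_univ_two,
      show toMat k hn s l 1 0 = 0 from hl, zero_mul, zero_add]
    by_cases ha : label a = 0
    · rw [matArrow_of_eq hn a ha]; simp
    · rw [matArrow_of_ne hn a ha]; simp

/-- On the image of `BorelAlg` the representation is diagonal, with the identity in the corner. -/
theorem toMat_incl (hn : 1 ≤ n) (b : BorelAlg k n (s + 1)) :
    toMat k hn s (incl k n s b) 0 0 = b ∧ toMat k hn s (incl k n s b) 0 1 = 0 := by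
  let S : Submodule k (BorelAlg k n (s + 1)) :=
    { carrier := {b | toMat k hn s (incl k n s b) 0 0 = b ∧ toMat k hn s (incl k n s b) 0 1 = 0}
      add_mem' := fun {a b} ha hb => by
        constructor
        · rw [map_add, map_add, Matrix.add_apply, ha.1, hb.1]
        · rw [map_add, map_add, Matrix.add_apply, ha.2, hb.2, add_zero]
      zero_mem' := by simp
      smul_mem' := fun c a ha => by
        constructor
        · rw [map_smul, map_smul, Matrix.smul_apply, ha.1]
        · rw [map_smul, map_smul, Matrix.smul_apply, ha.2, smul_zero] }
  refine QuiverAlg.mem_of_mul_mem S ?_ (fun l hl x => ?_) (fun l hl x y a => ?_) b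
  · constructor
    · rw [map_one, map_one]; rfl
    · rw [map_one, map_one]; rfl
  · have hx : incl k n s (QuiverAlg.e k _ x) = coverIdem k n s (inclVtx x) := incl_bE x
    constructor
    · rw [map_mul, map_mul, Matrix.mul_apply, Fin.sum_univ_two, hl.1, hl.2, hx, toMat_coverIdem]
      simp [bE, inclVtx]
    · rw [map_mul, map_mul, Matrix.mul_apply, Fin.sum_univ_two, hl.1, hl.2, hx, toMat_coverIdem]
      simp
  · have ha : incl k n s (QuiverAlg.arrow k _ a) = coverArrow k n s (inclArrow a) := incl_bA a
    have ha' := toMat_coverArrow (k := k) hn (inclArrow a)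
    rw [matArrow_of_ne hn (inclArrow a) a.2] at ha'
    constructor
    · rw [map_mul, map_mul, Matrix.mul_apply, Fin.sum_univ_two, hl.1, hl.2, ha, ha', zero_mul,
        add_zero]
      rfl
    · rw [map_mul, map_mul, Matrix.mul_apply, Fin.sum_univ_two, hl.1, hl.2, ha, ha', zero_mul,
        add_zero]
      exact mul_zero _

/-- The arrow `α_0` that ends in `x`; zero if there is none. -/
noncomputable def into (k : Type u) [Field k] (hn : 1 ≤ n) (x : Vtx n (s + 1)) : Cover k n s :=
  if h : 0 < x.1 0 then coverArrow k n s (x := shift hn (s + 1) x) ⟨0, shift_spec hn h⟩ else 0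

theorem into_of_pos (hn : 1 ≤ n) {x : Vtx n (s + 1)} (h : 0 < x.1 0) :
    into k hn x = coverArrow k n s (x := shift hn (s + 1) x) ⟨0, shift_spec hn h⟩ := dif_pos h

theorem into_of_eq_zero (hn : 1 ≤ n) {x : Vtx n (s + 1)} (h : x.1 0 = 0) :
    into k hn x = 0 := dif_neg (by omega)

theorem coverArrow_eq_into (hn : 1 ≤ n) {x y : Vtx n (s + 1)} (a : x ⟶ y) (ha : label a = 0) :
    coverArrow k n s a = into k hn y := by
  rw [into_of_pos hn (pos_of_label_eq_zero hn a ha)]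
  exact coverArrow_congr _ _ (shift_eq hn a ha).symm rfl ha

theorem into_mul_coverIdem (hn : 1 ≤ n) (x : Vtx n (s + 1)) :
    into k hn x * coverIdem k n s x = into k hn x := by
  rw [into]
  split_ifs
  · exact QuiverAlg.arrow_mul_e _
  · exact zero_mul _

theorem coverIdem_mul_into (hn : 1 ≤ n) (x : Vtx n (s + 1)) :
    coverIdem k n s (shift hn (s + 1) x) * into k hn x = into k hn x := by
  rw [into]
  split_ifs
  · exact QuiverAlg.e_mul_arrow _
  · exact mul_zero _

theorem into_shift_mul_into (hn : 1 ≤ n) (x : Vtx n (s + 1)) :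
    into k hn (shift hn (s + 1) x) * into k hn x = 0 := by
  by_cases h : 0 < x.1 0
  · by_cases h' : 0 < (shift hn (s + 1) x).1 0
    · rw [into_of_pos hn h, into_of_pos hn h']
      exact coverArrow_square _ _ rfl
    · rw [into_of_eq_zero hn (x := shift hn (s + 1) x) (by omega), zero_mul]
  · rw [into_of_eq_zero hn (x := x) (by omega), mul_zero]

/-- The sum of all arrows `α_0`. -/
noncomputable def alphaZero (k : Type u) [Field k] (hn : 1 ≤ n) (s : ℕ) : Cover k n s :=
  ∑ x : Vtx n (s + 1), into k hn x

theorem alphaZero_mul_coverIdem (hn : 1 ≤ n) (x : Vtx n (s + 1)) :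
    alphaZero k hn s * coverIdem k n s x = into k hn x := by
  rw [alphaZero, Finset.sum_mul, Finset.sum_eq_single x (fun y _ hy => ?_)
    (fun H => absurd (Finset.mem_univ x) H), into_mul_coverIdem]
  rw [← into_mul_coverIdem, mul_assoc, coverIdem_mul_of_ne hy, mul_zero]

theorem coverIdem_mul_alphaZero (hn : 1 ≤ n) (x : Vtx n (s + 1)) :
    coverIdem k n s (shift hn (s + 1) x) * alphaZero k hn s = into k hn x := by
  rw [alphaZero, Finset.mul_sum, Finset.sum_eq_single x (fun y _ hy => ?_)
    (fun H => absurd (Finset.mem_univ x) H), coverIdem_mul_into]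
  rw [← coverIdem_mul_into, ← mul_assoc,
    coverIdem_mul_of_ne fun H => hy ((shift hn (s + 1)).injective H).symm, zero_mul]

theorem alphaZero_mul_into (hn : 1 ≤ n) (x : Vtx n (s + 1)) :
    alphaZero k hn s * into k hn x = 0 := by
  rw [← coverIdem_mul_into, ← mul_assoc, alphaZero_mul_coverIdem, into_shift_mul_into]

theorem alphaZero_mul_self (hn : 1 ≤ n) : alphaZero k hn s * alphaZero k hn s = 0 := by
  conv_lhs => arg 2; rw [alphaZero]
  rw [Finset.mul_sum]
  exact Finset.sum_eq_zero fun x _ => alphaZero_mul_into hn x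

/-- Moving `α_0` past an arrow of `Q'` shifts the arrow. The shift fails to exist only for
`α_0 α_1` starting at a vertex `z` with `z_0 = 0`, and this product vanishes. -/
theorem alphaZero_mul_incl_bA (hn : 1 ≤ n) {x y : DirVtx n (s + 1)} (a : x ⟶ y) :
    alphaZero k hn s * incl k n s (bA k a) = incl k n s (shiftArrow k hn a) * alphaZero k hn s := by
  have h1 : alphaZero k hn s * incl k n s (bA k a) =
      into k hn (inclVtx x) * coverArrow k n s (inclArrow a) := by
    rw [← bE_mul_bA, map_mul, incl_bE, ← mul_assoc, alphaZero_mul_coverIdem, incl_bA]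
  have h2 : incl k n s (shiftArrow k hn a) * alphaZero k hn s =
      incl k n s (shiftArrow k hn a) * into k hn (inclVtx y) := by
    rw [← shiftArrow_mul_bE, map_mul, incl_bE, mul_assoc, coverIdem_mul_alphaZero, mul_assoc,
      coverIdem_mul_into]
  rw [h1, h2]
  by_cases hy : 0 < (inclVtx y).1 0
  · obtain ⟨a', ha, ha'⟩ := shiftArrow_eq (k := k) hn a hy
    have h3 : incl k n s (shiftArrow k hn a) = coverArrow k n s (inclArrow a') := by
      rw [ha']
      exact incl_bA a'
    rw [h3, into_of_pos hn hy, into_of_pos hn (pos_of_pos (inclArrow a) a.2 hy)]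
    exact coverArrow_comm _ _ _ _ rfl ha.symm
  · rw [into_of_eq_zero hn (x := inclVtx y) (by omega), mul_zero]
    by_cases hx : 0 < (inclVtx x).1 0
    · obtain ⟨h3, h4⟩ := shift_zero_eq hn (inclArrow a) hx (by omega)
      rw [into_of_pos hn hx]
      exact coverArrow_cut h4 _ _ rfl h3
    · rw [into_of_eq_zero hn (x := inclVtx x) (by omega), zero_mul]

/-- The cover is spanned by the images of `b` and `b α_0` for `b` in `BorelAlg`. -/
theorem exists_eq_incl_add (hn : 1 ≤ n) (l : Cover k n s) :
    ∃ b b' : BorelAlg k n (s + 1), l = incl k n s b + incl k n s b' * alphaZero k hn s := by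
  let S : Submodule k (Cover k n s) :=
    { carrier := {l | ∃ b b' : BorelAlg k n (s + 1),
        l = incl k n s b + incl k n s b' * alphaZero k hn s}
      add_mem' := by
        rintro _ _ ⟨b, b', rfl⟩ ⟨c, c', rfl⟩
        exact ⟨b + c, b' + c', by rw [map_add, map_add, add_mul]; abel⟩
      zero_mem' := ⟨0, 0, by simp⟩
      smul_mem' := by
        rintro c _ ⟨b, b', rfl⟩
        exact ⟨c • b, c • b', by rw [map_smul, map_smul, smul_add, smul_mul_assoc]⟩ }
  refine QuiverAlg.mem_of_mul_mem S ⟨1, 0, by simp⟩ ?_ ?_ l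
  · rintro _ ⟨b, b', rfl⟩ x
    refine ⟨b * bE k x, b' * bE k (shift hn (s + 1) x), ?_⟩
    rw [map_mul, map_mul, incl_bE, incl_bE, add_mul, mul_assoc (incl k n s b'),
      mul_assoc (incl k n s b'), coverIdem_mul_alphaZero, ← alphaZero_mul_coverIdem]
    rfl
  · rintro _ ⟨b, b', rfl⟩ x y a
    change ∃ c c', (_ + _) * coverArrow k n s a = _
    by_cases ha : label a = 0
    · refine ⟨0, b * bE k (shift hn (s + 1) y), ?_⟩
      rw [coverArrow_eq_into hn a ha, add_mul, mul_assoc (incl k n s b'), alphaZero_mul_into,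
        mul_zero, add_zero, map_zero, zero_add, map_mul, incl_bE, mul_assoc,
        coverIdem_mul_alphaZero]
    · set a' : @Quiver.Hom (DirVtx n (s + 1)) _ x y := ⟨a, ha⟩
      refine ⟨b * bA k a', b' * shiftArrow k hn a', ?_⟩
      have h : coverArrow k n s a = incl k n s (bA k a') := (incl_bA a').symm
      have h' : alphaZero k hn s * coverArrow k n s a =
          incl k n s (shiftArrow k hn a') * alphaZero k hn s := by
        rw [h]
        exact alphaZero_mul_incl_bA hn a'
      rw [add_mul, map_mul, map_mul, mul_assoc (incl k n s b'), h', h,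
        mul_assoc (incl k n s b')]

/-- The left `BorelAlg`-linear map from the cover to the entry `(0, j)` of the representation. -/
noncomputable def coordMap (k : Type u) [Field k] (hn : 1 ≤ n) (s : ℕ) (j : Fin 2) :
    Cover k n s →ₗ[k] BorelAlg k n (s + 1) :=
  (Matrix.entryLinearMap k _ 0 j).comp (toMat k hn s).toLinearMap

theorem coordMap_apply (hn : 1 ≤ n) (j : Fin 2) (l : Cover k n s) :
    coordMap k hn s j l = toMat k hn s l 0 j := rfl

theorem coordMap_mul (hn : 1 ≤ n) (j : Fin 2) (b : BorelAlg k n (s + 1)) (l : Cover k n s) :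
    coordMap k hn s j (incl k n s b * l) = b * coordMap k hn s j l := by
  rw [coordMap_apply, map_mul, Matrix.mul_apply, Fin.sum_univ_two, (toMat_incl hn b).1,
    (toMat_incl hn b).2, zero_mul, add_zero, coordMap_apply]

theorem toMat_into_fst (hn : 1 ≤ n) (x : Vtx n (s + 1)) : toMat k hn s (into k hn x) 0 0 = 0 := by
  by_cases h : 0 < x.1 0
  · rw [into_of_pos hn h, toMat_coverArrow, matArrow_of_eq hn _ rfl]; rfl
  · rw [into_of_eq_zero hn (by omega), map_zero]; rfl

theorem incl_toMat_into_mul (hn : 1 ≤ n) (x : Vtx n (s + 1)) :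
    incl k n s (toMat k hn s (into k hn x) 0 1) * alphaZero k hn s = into k hn x := by
  by_cases h : 0 < x.1 0
  · have : toMat k hn s (into k hn x) 0 1 = bE k (shift hn (s + 1) x) := by
      rw [into_of_pos hn h, toMat_coverArrow, matArrow_of_eq hn _ rfl]; rfl
    rw [this, incl_bE, coverIdem_mul_alphaZero]
  · rw [into_of_eq_zero hn (by omega), map_zero, Matrix.zero_apply, map_zero, zero_mul]

theorem coordMap_zero_alphaZero (hn : 1 ≤ n) : coordMap k hn s 0 (alphaZero k hn s) = 0 := by
  rw [alphaZero, map_sum]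
  exact Finset.sum_eq_zero fun x _ => toMat_into_fst hn x

theorem incl_coordMap_alphaZero (hn : 1 ≤ n) :
    incl k n s (coordMap k hn s 1 (alphaZero k hn s)) * alphaZero k hn s = alphaZero k hn s := by
  conv_lhs => arg 1; rw [alphaZero]
  rw [map_sum, map_sum, Finset.sum_mul]
  conv_rhs => rw [alphaZero]
  exact Finset.sum_congr rfl fun x _ => incl_toMat_into_mul hn x

theorem basicAugmentation_borelAlg (k : Type u) [Field k] (n s : ℕ) :
    BasicAugmentation (I := Vtx n s) (bE k)
      (QuiverAlg.aug (V := DirVtx n s) {r | BorelRel k n s r}) :=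
  QuiverAlg.basicAugmentation (V := DirVtx n s) (h := height) fun _ _ a => height_arrow a

/-- The cover is a split extension of the bound path algebra of `Q'`. -/
theorem splitExtension_incl (hn : 1 ≤ n) (s : ℕ) :
    SplitExtension (I := Vtx n (s + 1)) (incl k n s) (bE k)
      (QuiverAlg.aug (V := DirVtx n (s + 1)) {r | BorelRel k n (s + 1) r})
      (coordMap k hn s 0) (coordMap k hn s 1) (alphaZero k hn s) where
  base := basicAugmentation_borelAlg k n (s + 1)
  triangular i j b hb hij := by
    have h := QuiverAlg.e_mul_mul_e (V := DirVtx n (s + 1)) (fun x y => inclVtx x < inclVtx y)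
      (fun _ _ _ => lt_trans) (fun _ _ a => lt_of_arrow a) b
    by_cases hne : i = j
    · subst hne
      exact (h.2 i hij).trans ((congrArg (· • _) (congrFun hb i)).trans (zero_smul k _))
    · exact h.1 i j hij hne
  fst_mul := coordMap_mul hn 0
  snd_mul := coordMap_mul hn 1
  fst_one := by rw [coordMap_apply, map_one]; rfl
  snd_one := by rw [coordMap_apply, map_one]; rfl
  fst_gen := coordMap_zero_alphaZero hn
  decomp l := by
    obtain ⟨b, b', rfl⟩ := exists_eq_incl_add hn l
    rw [map_add, map_add (coordMap k hn s 1), coordMap_mul, coordMap_mul, coordMap_zero_alphaZero,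
      mul_zero, add_zero, coordMap_apply, coordMap_apply, (toMat_incl hn b).1, (toMat_incl hn b).2, zero_add, map_mul,
      mul_assoc, incl_coordMap_alphaZero]
  shift x := by
    rw [incl_bE, alphaZero_mul_coverIdem]
    by_cases h : 0 < x.1 0
    · exact Or.inr ⟨_, lt_shift hn h, by rw [incl_bE, coverIdem_mul_alphaZero]⟩
    · exact Or.inl (into_of_eq_zero hn (by omega))

/-- The retraction of the cover onto the bound path algebra of `Q'`, which kills `α_0`. -/
noncomputable def retraction (k : Type u) [Field k] (hn : 1 ≤ n) (s : ℕ) :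
    Cover k n s →ₐ[k] BorelAlg k n (s + 1) :=
  AlgHom.ofLinearMap (coordMap k hn s 0) (splitExtension_incl hn s).fst_one fun l l' => by
    rw [coordMap_apply, map_mul, Matrix.mul_apply, Fin.sum_univ_two, toMat_lower, mul_zero,
      add_zero]
    rfl

theorem incl_injective (hn : 1 ≤ n) (s : ℕ) : Function.Injective (incl k n s) :=
  Function.LeftInverse.injective (g := coordMap k hn s 0) (splitExtension_incl hn s).fst_incl

theorem range_incl (k : Type u) [Field k] (n s : ℕ) : (incl k n s).range = borel k n s := by
  rw [← Algebra.map_top, ← QuiverAlg.adjoin_eq_top, AlgHom.map_adjoin, borel, Set.image_union]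
  congr 2
  · ext g
    constructor
    · rintro ⟨_, ⟨x, rfl⟩, rfl⟩
      exact ⟨x, (incl_bE x).symm⟩
    · rintro ⟨x, rfl⟩
      exact ⟨_, ⟨x, rfl⟩, incl_bE x⟩
  · ext g
    constructor
    · rintro ⟨_, ⟨x, y, a, rfl⟩, rfl⟩
      exact ⟨x, y, inclArrow a, a.2, incl_bA a⟩
    · rintro ⟨x, y, a, ha, rfl⟩
      exact ⟨_, ⟨x, y, ⟨a, ha⟩, rfl⟩, incl_bA (x := x) (y := y) ⟨a, ha⟩⟩

/-- The bound path algebra of `Q'` is isomorphic to the subalgebra `borel` of the cover. -/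
noncomputable def borelEquiv (k : Type u) [Field k] (hn : 1 ≤ n) (s : ℕ) :
    BorelAlg k n (s + 1) ≃ₐ[k] borel k n s :=
  (AlgEquiv.ofInjective (incl k n s) (incl_injective hn s)).trans
    (Subalgebra.equivOfEq _ _ (range_incl k n s))

theorem coe_borelEquiv (hn : 1 ≤ n) (b : BorelAlg k n (s + 1)) :
    (borel k n s).val (borelEquiv k hn s b) = incl k n s b := rfl

theorem borelEquiv_bE (hn : 1 ≤ n) :
    (fun x => borelEquiv k hn s (bE k x)) = borelIdem k n s :=
  funext fun x => Subtype.ext (incl_bE x)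

theorem finiteDimensional_borel (hn : 1 ≤ n) : FiniteDimensional k (borel k n s) := by
  have : FiniteDimensional k (BorelAlg k n (s + 1)) :=
    QuiverAlg.finiteDimensional (V := DirVtx n (s + 1)) (h := height) fun _ _ a => height_arrow a
  exact Module.Finite.equiv (borelEquiv k hn s).toLinearEquiv

theorem isDirectedAlgebra_borel (hn : 1 ≤ n) (s : ℕ) :
    IsDirectedAlgebra k (borelIdem k n s) := by
  have := finiteDimensional_borel (k := k) (s := s) hn
  have h := (splitExtension_incl (k := k) hn s).congr (borelEquiv k hn s) (borel k n s).val
    (coe_borelEquiv hn)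
  rw [borelEquiv_bE] at h
  exact h.isDirectedAlgebra

theorem isStrongExactBorel_borel (hn : 1 ≤ n) (s : ℕ) :
    IsStrongExactBorel (borel k n s) (coverIdem k n s) (borelIdem k n s) := by
  have := finiteDimensional_borel (k := k) (s := s) hn
  have h := (splitExtension_incl (k := k) hn s).congr (borelEquiv k hn s) (borel k n s).val
    (coe_borelEquiv hn)
  have hΓ := (splitExtension_incl (k := k) hn s).basicAugmentation (retraction k hn s)
    (fun _ => rfl) (alphaZero_mul_self hn)
  rw [borelEquiv_bE] at h
  have he : (fun x => incl k n s (bE k x)) = fun x => (borel k n s).val (borelIdem k n s x) :=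
    funext incl_bE
  rw [he] at hΓ
  exact h.isStrongExactBorel hΓ fun x y hxy => Subtype.ext (coverIdem_mul_of_ne hxy)

end Zigzag

/-! ### The quadratic dual of the higher Auslander algebra -/

namespace Zigzag

variable {k : Type u} [Field k] {n s : ℕ}

theorem dirLabel_spec {x y : DirVtx n s} (a : x ⟶ y) (j : Fin (n + 1)) :
    ((inclVtx y).1 j : ℤ) = (inclVtx x).1 j + stepVec (dirLabel a) j := a.1.2 j

theorem dirLabel_ne_zero {x y : DirVtx n s} (a : x ⟶ y) : dirLabel a ≠ 0 := a.2

/-- The arrow of `Q'` with a given label and given ends. -/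
def mkArrow {x y : DirVtx n s} (i : Fin (n + 1)) (hi : i ≠ 0)
    (h : ∀ j, ((inclVtx y).1 j : ℤ) = (inclVtx x).1 j + stepVec i j) : x ⟶ y :=
  ⟨⟨i, h⟩, hi⟩

/-- The vertex with the coordinates of `x` in reverse order. -/
def revVtx (x : DirVtx n s) : DirVtx n s :=
  show Vtx n s from ⟨fun j => (inclVtx x).1 (-1 - j),
    (congrArg (· + 1) (Equiv.sum_comp (Equiv.subLeft (-1 : Fin (n + 1))) (inclVtx x).1)).trans
      (inclVtx x).2⟩

theorem revVtx_apply (x : DirVtx n s) (j : Fin (n + 1)) :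
    (inclVtx (revVtx x)).1 j = (inclVtx x).1 (-1 - j) := rfl

theorem revVtx_revVtx (x : DirVtx n s) : revVtx (revVtx x) = x :=
  vtx_ext (x := inclVtx (revVtx (revVtx x))) (y := inclVtx x) fun j => by
    rw [revVtx_apply, revVtx_apply, sub_sub_cancel]

theorem revVtx_injective : Function.Injective (revVtx (n := n) (s := s)) :=
  Function.LeftInverse.injective revVtx_revVtx

theorem stepVec_neg (i j : Fin (n + 1)) : stepVec (-i) j = -stepVec i (-1 - j) := by
  rw [stepVec_apply, stepVec_apply]
  have h1 : j = -i ↔ -1 - j = i - 1 := by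
    constructor
    · rintro rfl; abel
    · intro h
      have : j = -1 - (-1 - j) := by abel
      rw [this, h]; abel
  have h2 : j = -i - 1 ↔ -1 - j = i := by
    constructor
    · rintro rfl; abel
    · rintro rfl; abel
  simp only [h1, h2]
  ring

/-- Reversal of the coordinates takes the arrow `α_i` to an arrow `α_{n+1-i}` in the opposite
direction. -/
def revArrow {x y : DirVtx n s} (a : x ⟶ y) : revVtx y ⟶ revVtx x :=
  mkArrow (-dirLabel a) (neg_ne_zero.2 (dirLabel_ne_zero a)) fun j => by
    rw [revVtx_apply, revVtx_apply, dirLabel_spec a, stepVec_neg]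
    ring

theorem dirLabel_revArrow {x y : DirVtx n s} (a : x ⟶ y) : dirLabel (revArrow a) = -dirLabel a :=
  rfl

/-- The exponent of the sign attached to an arrow `α_i` starting at `x`. The weights `min l (i - 1)`
are chosen such that an arrow `α_j` increases the exponent by one if `j < i`, and otherwise
preserves it. -/
def signWeight (i : Fin (n + 1)) (x : DirVtx n s) : ℕ :=
  ∑ l : Fin (n + 1), min (l : ℕ) (i - 1) * (inclVtx x).1 l

theorem signWeight_target {x y : DirVtx n s} (a : x ⟶ y) {j : Fin (n + 1)} :
    signWeight j y = signWeight j x + if dirLabel a < j then 1 else 0 := by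
  have h : (signWeight j y : ℤ) = signWeight j x +
      (min (dirLabel a : ℕ) (j - 1) - min ((dirLabel a - 1 : Fin (n + 1)) : ℕ) (j - 1) : ℤ) := by
    unfold signWeight
    push_cast
    simp only [dirLabel_spec a, mul_add, Finset.sum_add_distrib, stepVec_apply, mul_sub,
      Finset.sum_sub_distrib]
    simp
  have hi := val_sub_one_of_ne (dirLabel_ne_zero a)
  split_ifs with hlt <;> rw [Fin.lt_def] at hlt <;> omega

/-- The sign attached to an arrow of `Q'`. -/
def arrowSign (k : Type u) [Field k] {x y : DirVtx n s} (a : x ⟶ y) : k :=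
  (-1) ^ signWeight (dirLabel a) x

theorem arrowSign_mul_self {x y : DirVtx n s} (a : x ⟶ y) : arrowSign k a * arrowSign k a = 1 := by
  rw [arrowSign, ← pow_add, ← two_mul, pow_mul, neg_one_sq, one_pow]

/-- The signs turn commuting squares into anticommuting squares. -/
theorem arrowSign_mul {x y y' z : DirVtx n s} (a : x ⟶ y) (b : y ⟶ z) (c : x ⟶ y') (d : y' ⟶ z)
    (h : dirLabel a = dirLabel d) (h' : dirLabel b = dirLabel c) (hne : dirLabel a ≠ dirLabel b) :
    arrowSign k a * arrowSign k b = -(arrowSign k c * arrowSign k d) := by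
  simp only [arrowSign]
  rw [signWeight_target a, signWeight_target c, ← h, ← h']
  rcases lt_or_gt_of_ne hne with hlt | hlt
  · rw [if_pos hlt, if_neg hlt.not_gt]; ring
  · rw [if_pos hlt, if_neg hlt.not_gt]; ring

theorem arrowSign_congr {x y x' y' : DirVtx n s} (a : x ⟶ y) (a' : x' ⟶ y') (hx : x = x')
    (h : dirLabel a = dirLabel a') : arrowSign k a = arrowSign k a' := by
  subst hx
  rw [arrowSign, arrowSign, h]

/-- A path of length two in `Q'` is determined by its start and its labels. -/
theorem twoPath_ext {p p' : TwoPath (DirVtx n s)} (hx : p.x = p'.x)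
    (ha : dirLabel p.a = dirLabel p'.a) (hb : dirLabel p.b = dirLabel p'.b) : p = p' := by
  obtain ⟨a, b⟩ := p
  obtain ⟨a', b'⟩ := p'
  rename_i x y z x' y' z'
  simp only at hx ha hb
  subst hx
  have hy : y = y' := vtx_ext (x := inclVtx y) (y := inclVtx y') fun j => by
    rw [dirLabel_spec a, dirLabel_spec a', ha]
  subst hy
  have hz : z = z' := vtx_ext (x := inclVtx z) (y := inclVtx z') fun j => by
    rw [dirLabel_spec b, dirLabel_spec b', hb]
  subst hz
  rw [show a = a' from Subtype.ext (Subtype.ext ha), show b = b' from Subtype.ext (Subtype.ext hb)]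

/-- The path of length two in `Q'` whose reverse is a given path in the opposite quiver. -/
def unopPath {V : Type} [Quiver.{0} V] (q : TwoPath Vᵒᵖ) : TwoPath V := ⟨q.b.unop, q.a.unop⟩

theorem unopPath_op {V : Type} [Quiver.{0} V] (p : TwoPath V) : unopPath p.op = p := rfl

/-- The path `p'` is obtained from `p` by interchanging the labels. -/
def IsSwap (p p' : TwoPath (DirVtx n s)) : Prop :=
  p.x = p'.x ∧ dirLabel p.a = dirLabel p'.b ∧ dirLabel p.b = dirLabel p'.a

theorem IsSwap.symm {p p' : TwoPath (DirVtx n s)} (h : IsSwap p p') : IsSwap p' p :=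
  ⟨h.1.symm, h.2.2.symm, h.2.1.symm⟩

theorem IsSwap.eq {p p' p'' : TwoPath (DirVtx n s)} (h : IsSwap p p') (h' : IsSwap p p'') :
    p' = p'' :=
  twoPath_ext (h.1.symm.trans h'.1) (h.2.2.symm.trans h'.2.2) (h.2.1.symm.trans h'.2.1)

/-- A swapped path exists as soon as its first arrow does. -/
theorem exists_isSwap (p : TwoPath (DirVtx n s)) {y' : DirVtx n s} (c : p.x ⟶ y')
    (hc : dirLabel c = dirLabel p.b) : ∃ d : y' ⟶ p.z, IsSwap p ⟨c, d⟩ :=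
  ⟨mkArrow (dirLabel p.a) (dirLabel_ne_zero p.a) fun j => by
    rw [dirLabel_spec p.b, dirLabel_spec p.a, dirLabel_spec c, hc]; ring, rfl, rfl, hc.symm⟩

/-- The relations of the quadratic dual of the higher Auslander algebra. -/
abbrev dualRel (k : Type u) [Field k] (n s : ℕ) : Set (TwoPath (DirVtx n s)ᵒᵖ →₀ k) :=
  quadraticPerp k {r | AuslanderRel k n s r}

/-- The element of the quadratic dual given by an arrow of `Q'`, in the opposite direction. -/
noncomputable def dualArrow (k : Type u) [Field k] {x y : DirVtx n s} (a : x ⟶ y) :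
    QuadraticDual k {r | AuslanderRel k n s r} :=
  QuiverAlg.arrow k (dualRel k n s) a.op

theorem dualArrow_congr {x y x' y' : DirVtx n s} (a : x ⟶ y) (a' : x' ⟶ y') (hx : x = x')
    (hy : y = y') (h : dirLabel a = dirLabel a') : dualArrow k a = dualArrow k a' := by
  subst hx hy
  rw [show a = a' from Subtype.ext (Subtype.ext h)]

theorem single_op_apply (p p' : TwoPath (DirVtx n s)) [Decidable (p = p')] :
    (Finsupp.single p.op (1 : k)) p'.op = if p = p' then 1 else 0 := by
  classical
  rw [Finsupp.single_apply]
  have : p.op = p'.op ↔ p = p' :=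
    ⟨fun h => by rw [← unopPath_op p, h, unopPath_op], fun h => by rw [h]⟩
  simp only [this]

/-- A combination of reversed paths is a relation of the dual if and only if its coefficients are
invariant under swaps and supported on the paths that have a swap. -/
theorem mem_dualRel {d : TwoPath (DirVtx n s)ᵒᵖ →₀ k} : d ∈ dualRel k n s ↔
    (∀ p p' : TwoPath (DirVtx n s), IsSwap p p' → d p.op = d p'.op) ∧
      ∀ p : TwoPath (DirVtx n s), d p.op ≠ 0 → ∃ p', IsSwap p p' := by
  constructor
  · intro hd
    constructor
    · rintro ⟨a, b⟩ ⟨c, e⟩ ⟨hx, h, h'⟩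
      simp only at hx h h'
      subst hx
      rename_i y z y' z'
      have hz : z = z' := vtx_ext (x := inclVtx z) (y := inclVtx z') fun j => by
        rw [dirLabel_spec b, dirLabel_spec a, dirLabel_spec e, dirLabel_spec c, h, h']; ring
      subst hz
      have := hd _ (AuslanderRel.comm a b c e h h')
      rw [Finsupp.sum_sub_index (fun _ _ _ => sub_mul _ _ _),
        Finsupp.sum_single_index (by rw [zero_mul]), Finsupp.sum_single_index (by rw [zero_mul]),
        one_mul, one_mul, sub_eq_zero] at this
      exact this
    · rintro ⟨a, b⟩ hp
      by_contra H
      refine hp ?_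
      have := hd _ (AuslanderRel.zero a b fun y' c hc => H ?_)
      · rwa [Finsupp.sum_single_index (by rw [zero_mul]), one_mul] at this
      · obtain ⟨e, he⟩ := exists_isSwap ⟨a, b⟩ c hc
        exact ⟨_, he⟩
  · rintro ⟨h1, h2⟩ _ (⟨a, b, c, e, h, h'⟩ | ⟨a, b, h⟩)
    · rw [Finsupp.sum_sub_index (fun _ _ _ => sub_mul _ _ _),
        Finsupp.sum_single_index (by rw [zero_mul]), Finsupp.sum_single_index (by rw [zero_mul]),
        one_mul, one_mul, sub_eq_zero]
      exact h1 _ _ ⟨rfl, h, h'⟩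
    · rw [Finsupp.sum_single_index (by rw [zero_mul]), one_mul]
      by_contra H
      obtain ⟨⟨c, e⟩, hx, -, hc⟩ := h2 _ H
      simp only at hx hc
      subst hx
      exact h _ c hc.symm

/-- In the quadratic dual the arrows anticommute. -/
theorem dualArrow_mul {x y y' z : DirVtx n s} (a : x ⟶ y) (b : y ⟶ z) (c : x ⟶ y') (d : y' ⟶ z)
    (h : dirLabel a = dirLabel d) (h' : dirLabel b = dirLabel c) :
    dualArrow k b * dualArrow k a = -(dualArrow k d * dualArrow k c) := by
  classical
  have hs : IsSwap ⟨a, b⟩ ⟨c, d⟩ := ⟨rfl, h, h'⟩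
  have hmem : Finsupp.single (TwoPath.op ⟨a, b⟩) (1 : k) + Finsupp.single (TwoPath.op ⟨c, d⟩) 1 ∈
      dualRel k n s := by
    refine mem_dualRel.2 ⟨fun p p' hp => ?_, fun p hp => ?_⟩
    · simp only [Finsupp.add_apply, single_op_apply]
      have e1 : (⟨a, b⟩ : TwoPath (DirVtx n s)) = p ↔ (⟨c, d⟩ : TwoPath (DirVtx n s)) = p' :=
        ⟨fun H => by subst H; exact hs.eq hp, fun H => by subst H; exact hs.symm.eq hp.symm⟩
      have e2 : (⟨c, d⟩ : TwoPath (DirVtx n s)) = p ↔ (⟨a, b⟩ : TwoPath (DirVtx n s)) = p' :=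
        ⟨fun H => by subst H; exact hs.symm.eq hp, fun H => by subst H; exact hs.eq hp.symm⟩
      simp only [e1, e2]
      exact add_comm _ _
    · simp only [Finsupp.add_apply, single_op_apply] at hp
      by_cases h1 : (⟨a, b⟩ : TwoPath (DirVtx n s)) = p
      · subst h1; exact ⟨_, hs⟩
      · by_cases h2 : (⟨c, d⟩ : TwoPath (DirVtx n s)) = p
        · subst h2; exact ⟨_, hs.symm⟩
        · simp [h1, h2] at hp
  have := QuiverAlg.sum_arrow_mul_arrow hmem
  rw [Finsupp.sum_add_index' (fun _ => by rw [zero_smul]) (fun _ _ _ => add_smul _ _ _),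
    sum_smul_single (F := fun p => QuiverAlg.arrow k (dualRel k n s) p.a *
      QuiverAlg.arrow k (dualRel k n s) p.b),
    sum_smul_single (F := fun p => QuiverAlg.arrow k (dualRel k n s) p.a *
      QuiverAlg.arrow k (dualRel k n s) p.b)] at this
  exact eq_neg_of_add_eq_zero_left this

theorem dualArrow_square {x y z : DirVtx n s} (a : x ⟶ y) (b : y ⟶ z)
    (h : dirLabel a = dirLabel b) : dualArrow k b * dualArrow k a = 0 := by
  classical
  have hs : IsSwap ⟨a, b⟩ ⟨a, b⟩ := ⟨rfl, h, h.symm⟩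
  have hmem : Finsupp.single (TwoPath.op ⟨a, b⟩) (1 : k) ∈ dualRel k n s := by
    refine mem_dualRel.2 ⟨fun p p' hp => ?_, fun p hp => ?_⟩
    · simp only [single_op_apply]
      have e1 : (⟨a, b⟩ : TwoPath (DirVtx n s)) = p ↔ (⟨a, b⟩ : TwoPath (DirVtx n s)) = p' :=
        ⟨fun H => by subst H; exact hs.eq hp, fun H => by subst H; exact hs.eq hp.symm⟩
      simp only [e1]
    · simp only [single_op_apply] at hp
      by_cases h1 : (⟨a, b⟩ : TwoPath (DirVtx n s)) = p
      · subst h1; exact ⟨_, hs⟩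
      · simp [h1] at hp
  exact QuiverAlg.arrow_mul_arrow_eq_zero hmem

/-- The homomorphism from the bound path algebra of `Q'` to the quadratic dual that reverses the
coordinates and multiplies the arrows by signs. -/
noncomputable def toDual (k : Type u) [Field k] (n s : ℕ) :
    BorelAlg k n s →ₐ[k] QuadraticDual k {r | AuslanderRel k n s r} :=
  QuiverAlg.lift (fun x => QuiverAlg.e k (dualRel k n s) (Opposite.op (revVtx x)))
    (fun _ _ a => arrowSign k a • dualArrow k (revArrow a))
    (fun _ => QuiverAlg.e_mul_e _)
    (fun _ _ h => QuiverAlg.e_mul_e_of_ne fun H => h (revVtx_injective (Opposite.op_injective H)))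
    (by
      have hinv : Function.Involutive (revVtx (n := n) (s := s)) := revVtx_revVtx
      exact (Equiv.sum_comp ((hinv.toPerm revVtx).trans Opposite.equivToOpposite)
        (QuiverAlg.e k (dualRel k n s))).trans QuiverAlg.sum_e)
    (fun _ _ a => by
      rw [mul_smul_comm]
      exact congrArg _ (QuiverAlg.e_mul_arrow (revArrow a).op))
    (fun _ _ a => by
      rw [smul_mul_assoc]
      exact congrArg _ (QuiverAlg.arrow_mul_e (revArrow a).op))
    (by
      have hsq : ∀ {x y z : DirVtx n s} (a : x ⟶ y) (b : y ⟶ z), dirLabel a = dirLabel b →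
          (arrowSign k a • dualArrow k (revArrow a)) *
            (arrowSign k b • dualArrow k (revArrow b)) = 0 := by
        intro x y z a b h
        rw [smul_mul_smul_comm, dualArrow_square, smul_zero]
        rw [dirLabel_revArrow, dirLabel_revArrow, h]
      rintro _ (⟨a, b, c, d, h, h'⟩ | ⟨a, b, h⟩)
      · rw [sum_smul_single_sub (F := fun p => (arrowSign k p.a • dualArrow k (revArrow p.a)) *
          (arrowSign k p.b • dualArrow k (revArrow p.b))), sub_eq_zero]
        by_cases hne : dirLabel a = dirLabel b
        · rw [hsq a b hne, hsq c d (by rw [← h', ← h, hne])]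
        · rw [smul_mul_smul_comm, smul_mul_smul_comm, arrowSign_mul a b c d h h' hne,
            dualArrow_mul (revArrow b) (revArrow a) (revArrow d) (revArrow c), smul_neg, neg_smul,
            neg_neg]
          · rw [dirLabel_revArrow, dirLabel_revArrow, h']
          · rw [dirLabel_revArrow, dirLabel_revArrow, h]
      · rw [sum_smul_single (F := fun p => (arrowSign k p.a • dualArrow k (revArrow p.a)) *
          (arrowSign k p.b • dualArrow k (revArrow p.b)))]
        exact hsq a b h)

theorem toDual_e (x : DirVtx n s) : toDual k n s (QuiverAlg.e k _ x) =
    QuiverAlg.e k (dualRel k n s) (Opposite.op (revVtx x)) := QuiverAlg.lift_e x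

theorem toDual_arrow {x y : DirVtx n s} (a : x ⟶ y) : toDual k n s (QuiverAlg.arrow k _ a) =
    arrowSign k a • dualArrow k (revArrow a) := QuiverAlg.lift_arrow a

/-- The image of an arrow `a.op` of the opposite quiver in the bound path algebra of `Q'`. -/
noncomputable def revElt (k : Type u) [Field k] {x y : DirVtx n s} (a : x ⟶ y) : BorelAlg k n s :=
  arrowSign k (revArrow a) • bA k (revArrow a)

theorem revElt_square {x y z : DirVtx n s} (a : x ⟶ y) (b : y ⟶ z)
    (h : dirLabel a = dirLabel b) : revElt k b * revElt k a = 0 := by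
  rw [revElt, revElt, smul_mul_smul_comm, bA_square, smul_zero]
  rw [dirLabel_revArrow, dirLabel_revArrow, h]

theorem revElt_mul {p p' : TwoPath (DirVtx n s)} (hp : IsSwap p p') :
    revElt k p.b * revElt k p.a + revElt k p'.b * revElt k p'.a = 0 := by
  obtain ⟨a, b⟩ := p
  obtain ⟨c, d⟩ := p'
  obtain ⟨hx, h, h'⟩ := hp
  simp only at hx h h' ⊢
  subst hx
  rename_i y z y' z'
  have hz : z = z' := vtx_ext (x := inclVtx z) (y := inclVtx z') fun j => by
    rw [dirLabel_spec b, dirLabel_spec a, dirLabel_spec d, dirLabel_spec c, h, h']; ring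
  subst hz
  by_cases hne : dirLabel a = dirLabel b
  · rw [revElt_square a b hne, revElt_square c d (by rw [← h', ← h, hne]), add_zero]
  · have h1 : dirLabel (revArrow b) = dirLabel (revArrow c) := by
      rw [dirLabel_revArrow, dirLabel_revArrow, h']
    have h2 : dirLabel (revArrow a) = dirLabel (revArrow d) := by
      rw [dirLabel_revArrow, dirLabel_revArrow, h]
    rw [revElt, revElt, revElt, revElt, smul_mul_smul_comm, smul_mul_smul_comm,
      bA_comm (revArrow b) (revArrow a) (revArrow d) (revArrow c) h1 h2,
      arrowSign_mul (revArrow b) (revArrow a) (revArrow d) (revArrow c) h1 h2, neg_smul,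
      neg_add_cancel]
    rw [dirLabel_revArrow, dirLabel_revArrow]
    exact fun H => hne (neg_injective H).symm

/-- The inverse of `toDual`. The relations of the dual hold because their terms cancel in pairs:
the coefficients of a path and of its swap agree, and their images are opposite to each other. -/
noncomputable def ofDual (k : Type u) [Field k] (n s : ℕ) :
    QuadraticDual k {r | AuslanderRel k n s r} →ₐ[k] BorelAlg k n s :=
  QuiverAlg.lift (fun x => QuiverAlg.e k {r | BorelRel k n s r} (revVtx x.unop))
    (fun _ _ a => revElt k a.unop)
    (fun _ => QuiverAlg.e_mul_e _)
    (fun _ _ h => QuiverAlg.e_mul_e_of_ne fun H => h (Opposite.unop_injective (revVtx_injective H)))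
    (by
      have hinv : Function.Involutive (revVtx (n := n) (s := s)) := revVtx_revVtx
      exact (Equiv.sum_comp (Opposite.equivToOpposite.symm.trans (hinv.toPerm revVtx))
        (QuiverAlg.e k {r | BorelRel k n s r})).trans QuiverAlg.sum_e)
    (fun _ _ a => by
      rw [revElt, mul_smul_comm]
      exact congrArg _ (QuiverAlg.e_mul_arrow (revArrow a.unop)))
    (fun _ _ a => by
      rw [revElt, smul_mul_assoc]
      exact congrArg _ (QuiverAlg.arrow_mul_e (revArrow a.unop)))
    (by
      intro d hd
      obtain ⟨h1, h2⟩ := mem_dualRel.1 hd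
      have hex : ∀ q ∈ d.support, ∃ q', IsSwap (unopPath q) (unopPath q') := by
        intro q hq
        obtain ⟨p', hp'⟩ := h2 (unopPath q) (Finsupp.mem_support_iff.1 hq)
        exact ⟨p'.op, hp'⟩
      choose g hg using hex
      have hd' : ∀ q hq, d (g q hq) = d q := fun q hq => (h1 _ _ (hg q hq)).symm
      have hmem : ∀ q hq, g q hq ∈ d.support := fun q hq => by
        rw [Finsupp.mem_support_iff, hd']
        exact Finsupp.mem_support_iff.1 hq
      refine Finset.sum_involution g (fun q hq => ?_) (fun q hq hne heq => hne ?_) hmem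
        fun q hq => ?_
      · rw [hd', ← smul_add]
        exact (congrArg _ (revElt_mul (hg q hq))).trans (smul_zero _)
      · have := hg q hq
        rw [heq] at this
        exact (congrArg _ (revElt_square _ _ this.2.1)).trans (smul_zero _)
      · exact congrArg TwoPath.op ((hg _ (hmem q hq)).eq (hg q hq).symm))

theorem ofDual_e (x : (DirVtx n s)ᵒᵖ) : ofDual k n s (QuiverAlg.e k (dualRel k n s) x) =
    QuiverAlg.e k {r | BorelRel k n s r} (revVtx x.unop) := QuiverAlg.lift_e x

theorem ofDual_dualArrow {x y : DirVtx n s} (a : x ⟶ y) :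
    ofDual k n s (dualArrow k a) = revElt k a := QuiverAlg.lift_arrow a.op

/-- The bound path algebra of `Q'` is the quadratic dual of the higher Auslander algebra. -/
noncomputable def dualEquiv (k : Type u) [Field k] (n s : ℕ) :
    BorelAlg k n s ≃ₐ[k] QuadraticDual k {r | AuslanderRel k n s r} :=
  AlgEquiv.ofAlgHom (toDual k n s) (ofDual k n s)
    (QuiverAlg.algHom_ext
      (fun x => by
        change toDual k n s (ofDual k n s _) = _
        rw [ofDual_e, toDual_e, revVtx_revVtx]
        rfl)
      (fun x y a => by
        change toDual k n s (ofDual k n s (dualArrow k a.unop)) = dualArrow k a.unop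
        rw [ofDual_dualArrow, revElt, map_smul, bA, toDual_arrow, smul_smul, arrowSign_mul_self,
          one_smul]
        exact dualArrow_congr _ _ (revVtx_revVtx _) (revVtx_revVtx _) (neg_neg _)))
    (QuiverAlg.algHom_ext
      (fun x => by
        change ofDual k n s (toDual k n s _) = _
        rw [toDual_e, ofDual_e]
        change QuiverAlg.e k _ (revVtx (revVtx x)) = _
        rw [revVtx_revVtx]
        rfl)
      (fun x y a => by
        change ofDual k n s (toDual k n s _) = bA k a
        rw [toDual_arrow, map_smul, ofDual_dualArrow, revElt, smul_smul,
          arrowSign_congr (revArrow (revArrow a)) a (revVtx_revVtx _) (neg_neg _),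
          arrowSign_mul_self, one_smul]
        exact bA_congr _ _ (revVtx_revVtx _) (revVtx_revVtx _) (neg_neg _)))

end Zigzag

theorem mainTheorem2 (k : Type u) [Field k] [IsAlgClosed k] (n s : ℕ) (hn : 1 ≤ n) (hs : 1 ≤ s) :
    -- the subalgebra `B` is the path algebra of `Q'` bound by commutativity and zero relations
    (∃ φ : QuiverAlg k {r | Zigzag.BorelRel k n (s + 1) r} →ₐ[k] Zigzag.Cover k n s,
      (∀ x, φ (QuiverAlg.e k _ x) = Zigzag.coverIdem k n s (Zigzag.inclVtx x)) ∧
      (∀ (x y : DirVtx n (s + 1)) (a : x ⟶ y),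
        φ (QuiverAlg.arrow k _ a) = Zigzag.coverArrow k n s (Zigzag.inclArrow a)) ∧
      Function.Injective φ ∧ φ.range = Zigzag.borel k n s) ∧
    -- `B` is directed
    IsDirectedAlgebra k (Zigzag.borelIdem k n s) ∧
    -- `B` is isomorphic to the quadratic dual of the higher Auslander algebra `Λ^(n,s+1)`
    Nonempty (Zigzag.borel k n s ≃ₐ[k]
      QuadraticDual k {r | Zigzag.AuslanderRel k n (s + 1) r}) ∧
    -- `B` is a strong exact Borel subalgebra of the quasi-hereditary algebra `Γ`
    IsStrongExactBorel (Zigzag.borel k n s) (Zigzag.coverIdem k n s)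
      (Zigzag.borelIdem k n s) :=
  ⟨⟨Zigzag.incl k n s, Zigzag.incl_bE, fun _ _ => Zigzag.incl_bA, Zigzag.incl_injective hn s,
      Zigzag.range_incl k n s⟩,
    Zigzag.isDirectedAlgebra_borel hn s,
    ⟨(Zigzag.borelEquiv k hn s).symm.trans (Zigzag.dualEquiv k n (s + 1))⟩,
    Zigzag.isStrongExactBorel_borel hn s⟩
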